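/- Let $K$ be a field of characteristic zero. For a commutative $K$-algebra $R$, let $D^0(R)$ be the set of $\theta\in\operatorname{End}_K(R)$ with $\theta a-a\theta=0$ for all $a\in R$ (where $a$ acts by multiplication), for $m\ge 1$ let $D^m(R)$ be the set of $\theta\in\operatorname{End}_K(R)$ with $\theta a-a\theta\in D^{m-1}(R)$ for all $a\in R$, and let $D(R)=\bigcup_{m\ge 0}D^m(R)$ be the ring of differential operators of $R$. For an ideal $J$ of $R$ put $D(J)=\{\theta\in D(R)\mid\theta(J)\subseteq J\}$, a subring of $D(R)$, and let $JD(R)\subseteq D(J)$ be the set of finite sums of operators $f\theta$ with $f\in J$ and $\theta\in D(R)$. Let $S=K[x,y]$, let $H_1,\dots,H_r$ be distinct lines through the origin in $K^2$, let $p_i\in S$ be a linear form with zero set $H_i$, and let $I=QS$ with $Q=p_1\cdots p_r$. Then $ID(S)$ is a two-sided ideal of $D(I)$, the assignment $\theta\mapsto\big(f+I\mapsto\theta(f)+I\big)$ induces a ring isomorphism $D(I)/ID(S)\simeq D(S/I)$, and the ring $D(S/I)\simeq D(I)/ID(S)$ is both right Noetherian and left Noetherian. -/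

import Mathlib

namespace DiffOp

section General

variable (K : Type*) (R : Type*) [CommRing K] [CommRing R] [Algebra K R]

/-- The differential operators of order at most `m` on the commutative `K`-algebra `R`:
`D^0(R)` is the set of `θ ∈ End_K(R)` with `θ a - a θ = 0` for all `a ∈ R`, and `D^(m+1)(R)` is
the set of `θ` with `θ a - a θ ∈ D^m(R)` for all `a ∈ R`, where `a` acts by multiplication. -/
def ofOrder : ℕ → Submodule K (Module.End K R)
  | 0 =>
    { carrier := {θ | ∀ a : R, θ * LinearMap.mulLeft K a - LinearMap.mulLeft K a * θ = 0}
      zero_mem' := fun a => by simp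
      add_mem' := fun {θ η} hθ hη a => by
        have h := congrArg₂ (· + ·) (hθ a) (hη a)
        simp only [add_zero] at h
        rw [← h, add_mul, mul_add]
        abel
      smul_mem' := fun c θ hθ a => by
        rw [smul_mul_assoc, mul_smul_comm, ← smul_sub, hθ a, smul_zero] }
  | m + 1 =>
    { carrier := {θ | ∀ a : R,
        θ * LinearMap.mulLeft K a - LinearMap.mulLeft K a * θ ∈ ofOrder m}
      zero_mem' := fun a => by simp
      add_mem' := fun {θ η} hθ hη a => by
        have h := (ofOrder m).add_mem (hθ a) (hη a)
        convert h using 1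
        rw [add_mul, mul_add]
        abel
      smul_mem' := fun c θ hθ a => by
        rw [smul_mul_assoc, mul_smul_comm, ← smul_sub]
        exact (ofOrder m).smul_mem c (hθ a) }

variable {K R}

theorem mem_ofOrder_zero {θ : Module.End K R} : θ ∈ ofOrder K R 0 ↔
    ∀ a : R, θ * LinearMap.mulLeft K a - LinearMap.mulLeft K a * θ = 0 := Iff.rfl

theorem mem_ofOrder_succ {m : ℕ} {θ : Module.End K R} : θ ∈ ofOrder K R (m + 1) ↔
    ∀ a : R, θ * LinearMap.mulLeft K a - LinearMap.mulLeft K a * θ ∈ ofOrder K R m := Iff.rfl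

theorem ofOrder_le_succ (m : ℕ) : ofOrder K R m ≤ ofOrder K R (m + 1) := by
  induction m with
  | zero =>
    intro θ hθ a
    rw [mem_ofOrder_zero.1 hθ a]
    exact Submodule.zero_mem _
  | succ m ih => exact fun θ hθ a => ih (hθ a)

theorem ofOrder_mono {m n : ℕ} (h : m ≤ n) : ofOrder K R m ≤ ofOrder K R n :=
  monotone_nat_of_le_succ (f := ofOrder K R) ofOrder_le_succ h

theorem mulLeft_mem_ofOrder_zero (a : R) : LinearMap.mulLeft K a ∈ ofOrder K R 0 := by
  rw [mem_ofOrder_zero]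
  intro b
  ext x
  simp [mul_left_comm]

theorem mul_mem_ofOrder (k : ℕ) : ∀ (m n : ℕ), m + n = k → ∀ θ ∈ ofOrder K R m,
    ∀ η ∈ ofOrder K R n, θ * η ∈ ofOrder K R k := by
  induction k with
  | zero =>
    intro m n h θ hθ η hη
    obtain ⟨rfl, rfl⟩ : m = 0 ∧ n = 0 := by omega
    rw [mem_ofOrder_zero] at *
    intro a
    rw [mul_assoc, sub_eq_zero.1 (hη a), ← mul_assoc, sub_eq_zero.1 (hθ a), mul_assoc, sub_self]
  | succ k ih =>
    intro m n h θ hθ η hη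
    rw [mem_ofOrder_succ]
    intro a
    have e : θ * η * LinearMap.mulLeft K a - LinearMap.mulLeft K a * (θ * η) =
        θ * (η * LinearMap.mulLeft K a - LinearMap.mulLeft K a * η) +
        (θ * LinearMap.mulLeft K a - LinearMap.mulLeft K a * θ) * η := by
      rw [mul_sub, sub_mul, mul_assoc, mul_assoc, mul_assoc]
      abel
    rw [e]
    refine Submodule.add_mem _ ?_ ?_
    · cases n with
      | zero =>
        rw [mem_ofOrder_zero.1 hη a, mul_zero]
        exact Submodule.zero_mem _
      | succ n => exact ih m n (by omega) _ hθ _ (hη a)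
    · cases m with
      | zero =>
        rw [mem_ofOrder_zero.1 hθ a, zero_mul]
        exact Submodule.zero_mem _
      | succ m => exact ih m n (by omega) _ (hθ a) _ hη

variable (K R)

/-- The ring `D(R) = ⋃ₘ D^m(R)` of differential operators of the commutative `K`-algebra `R`. -/
def ring : Subalgebra K (Module.End K R) where
  carrier := {θ | ∃ m, θ ∈ ofOrder K R m}
  mul_mem' := fun {_ _} ⟨m, hm⟩ ⟨n, hn⟩ => ⟨m + n, mul_mem_ofOrder _ m n rfl _ hm _ hn⟩
  add_mem' := fun {_ _} ⟨m, hm⟩ ⟨n, hn⟩ => ⟨max m n, Submodule.add_mem _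
    (ofOrder_mono (le_max_left m n) hm) (ofOrder_mono (le_max_right m n) hn)⟩
  algebraMap_mem' := fun c => ⟨0, by
    rw [mem_ofOrder_zero]
    intro a
    rw [Algebra.commutes c (LinearMap.mulLeft K a), sub_self]⟩

variable {K R}

theorem mulLeft_mem_ring (a : R) : LinearMap.mulLeft K a ∈ ring K R :=
  ⟨0, mulLeft_mem_ofOrder_zero a⟩

variable (K)

/-- The subring `D(J) = {θ ∈ D(R) ∣ θ(J) ⊆ J}` of `D(R)`, for an ideal `J` of `R`. -/
def preserving (J : Ideal R) : Subring (Module.End K R) where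
  carrier := {θ | θ ∈ ring K R ∧ ∀ f ∈ J, θ f ∈ J}
  mul_mem' := fun {_ _} ha hb => ⟨mul_mem ha.1 hb.1, fun f hf => ha.2 _ (hb.2 f hf)⟩
  add_mem' := fun {_ _} ha hb => ⟨add_mem ha.1 hb.1, fun f hf => J.add_mem (ha.2 f hf) (hb.2 f hf)⟩
  one_mem' := ⟨one_mem _, fun _ hf => hf⟩
  zero_mem' := ⟨zero_mem _, fun _ _ => J.zero_mem⟩
  neg_mem' := fun {_} ha => ⟨neg_mem ha.1, fun f hf => J.neg_mem (ha.2 f hf)⟩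

/-- `J D(R)`: the finite sums of operators `f θ` with `f ∈ J` and `θ ∈ D(R)`. -/
def idealMul (J : Ideal R) : Submodule K (Module.End K R) :=
  Submodule.span K {ψ | ∃ f ∈ J, ∃ θ ∈ ring K R, ψ = LinearMap.mulLeft K f * θ}

variable {K}

theorem idealMul_mul_mem (J : Ideal R) {ψ θ : Module.End K R} (hψ : ψ ∈ idealMul K J)
    (hθ : θ ∈ ring K R) : ψ * θ ∈ idealMul K J := by
  induction hψ using Submodule.span_induction with
  | mem x hx =>
    obtain ⟨f, hf, η, hη, rfl⟩ := hx
    exact Submodule.subset_span ⟨f, hf, η * θ, mul_mem hη hθ, mul_assoc _ _ _⟩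
  | zero => rw [zero_mul]; exact Submodule.zero_mem _
  | add x y _ _ hx hy => rw [add_mul]; exact Submodule.add_mem _ hx hy
  | smul c x _ hx => rw [smul_mul_assoc]; exact Submodule.smul_mem _ c hx

/-- `J D(R)` is contained in `D(J)`. -/
theorem idealMul_subset_preserving (J : Ideal R) :
    (idealMul K J : Set (Module.End K R)) ⊆ preserving K J := by
  intro ψ hψ
  induction hψ using Submodule.span_induction with
  | mem x hx =>
    obtain ⟨f, hf, θ, hθ, rfl⟩ := hx
    exact ⟨mul_mem (mulLeft_mem_ring f) hθ, fun g _ => J.mul_mem_right _ hf⟩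
  | zero => exact zero_mem (preserving K J)
  | add x y _ _ hx hy => exact add_mem (S := Subring (Module.End K R)) hx hy
  | smul c x _ hx =>
    refine ⟨Subalgebra.smul_mem _ hx.1 c, fun g hg => ?_⟩
    rw [LinearMap.smul_apply, Algebra.smul_def]
    exact J.mul_mem_left _ (hx.2 g hg)

end General

section Domain

variable {K : Type*} {R : Type*} [CommRing K] [CommRing R] [IsDomain R] [Algebra K R]

theorem mem_ofOrder_of_conj {q : R} (hq : q ≠ 0) (m : ℕ) : ∀ θ ∈ ofOrder K R m,
    ∀ θ' : Module.End K R,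
      θ * LinearMap.mulLeft K q = LinearMap.mulLeft K q * θ' → θ' ∈ ofOrder K R m := by
  have key : ∀ θ θ' : Module.End K R,
      θ * LinearMap.mulLeft K q = LinearMap.mulLeft K q * θ' → ∀ a : R,
      (θ * LinearMap.mulLeft K a - LinearMap.mulLeft K a * θ) * LinearMap.mulLeft K q =
        LinearMap.mulLeft K q * (θ' * LinearMap.mulLeft K a - LinearMap.mulLeft K a * θ') := by
    intro θ θ' h a
    have h' : ∀ g, θ (q * g) = q * θ' g := fun g => LinearMap.congr_fun h g
    ext g
    simp only [Module.End.mul_apply, LinearMap.sub_apply, LinearMap.mulLeft_apply, h']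
    rw [mul_left_comm a q g, h']
    ring
  induction m with
  | zero =>
    intro θ hθ θ' h
    rw [mem_ofOrder_zero] at *
    intro a
    have := key θ θ' h a
    rw [hθ a, zero_mul] at this
    ext g
    have hg := LinearMap.congr_fun this g
    exact (mul_eq_zero.1 hg.symm).resolve_left hq
  | succ m ih => exact fun θ hθ θ' h a => ih _ (hθ a) _ (key θ θ' h a)

theorem exists_conj {q : R} (hq : q ≠ 0) {θ : Module.End K R}
    (hθ : θ ∈ preserving K (Ideal.span {q})) :
    ∃ θ' ∈ ring K R, θ * LinearMap.mulLeft K q = LinearMap.mulLeft K q * θ' := by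
  have h : ∀ g : R, ∃ c : R, θ (q * g) = q * c := fun g =>
    Ideal.mem_span_singleton.1 (hθ.2 _ (Ideal.mem_span_singleton.2 (dvd_mul_right q g)))
  choose φ hφ using h
  let θ' : Module.End K R :=
    { toFun := φ
      map_add' := fun a b => mul_left_cancel₀ hq (by
        rw [← hφ, mul_add, map_add, hφ, hφ, mul_add])
      map_smul' := fun c a => mul_left_cancel₀ hq (by
        rw [← hφ, mul_smul_comm, map_smul, hφ, RingHom.id_apply, mul_smul_comm]) }
  have e : θ * LinearMap.mulLeft K q = LinearMap.mulLeft K q * θ' := LinearMap.ext hφ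
  obtain ⟨m, hm⟩ := hθ.1
  exact ⟨θ', ⟨m, mem_ofOrder_of_conj hq m θ hm θ' e⟩, e⟩

theorem mul_idealMul_mem (J : Ideal R) [hJ : J.IsPrincipal] {θ ψ : Module.End K R}
    (hθ : θ ∈ preserving K J) (hψ : ψ ∈ idealMul K J) : θ * ψ ∈ idealMul K J := by
  obtain ⟨q, rfl⟩ := hJ.principal
  change θ ∈ preserving K (Ideal.span {q}) at hθ
  change ψ ∈ idealMul K (Ideal.span {q}) at hψ
  change _ ∈ idealMul K (Ideal.span {q})
  induction hψ using Submodule.span_induction with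
  | mem x hx =>
    obtain ⟨f, hf, η, hη, rfl⟩ := hx
    obtain ⟨g, rfl⟩ := Ideal.mem_span_singleton.1 hf
    rcases eq_or_ne q 0 with rfl | hq
    · rw [zero_mul, LinearMap.mulLeft_zero_eq_zero, zero_mul, mul_zero]
      exact Submodule.zero_mem _
    · obtain ⟨θ', hθ', e⟩ := exists_conj hq hθ
      refine Submodule.subset_span ⟨q, Ideal.mem_span_singleton_self q,
        θ' * (LinearMap.mulLeft K g * η), mul_mem hθ' (mul_mem (mulLeft_mem_ring g) hη), ?_⟩
      rw [LinearMap.mulLeft_mul, ← Module.End.mul_eq_comp, mul_assoc, ← mul_assoc, e, mul_assoc]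
  | zero => rw [mul_zero]; exact Submodule.zero_mem _
  | add x y _ _ hx hy => rw [mul_add]; exact Submodule.add_mem _ hx hy
  | smul c x _ hx => rw [mul_smul_comm]; exact Submodule.smul_mem _ c hx

variable (K)

/-- `J D(R)` as an ideal of `D(J)`, for a principal ideal `J` of a domain `R`. -/
def idealMulIdeal (J : Ideal R) [J.IsPrincipal] : Ideal (preserving K J) where
  carrier := {θ | (θ : Module.End K R) ∈ idealMul K J}
  zero_mem' := (idealMul K J).zero_mem
  add_mem' := fun {_ _} ha hb => (idealMul K J).add_mem ha hb
  smul_mem' := fun c _ hx => mul_idealMul_mem J c.2 hx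

instance idealMulIdeal_isTwoSided (J : Ideal R) [J.IsPrincipal] :
    (idealMulIdeal K J).IsTwoSided :=
  ⟨fun {_} b ha => idealMul_mul_mem J ha b.2.1⟩

end Domain

/-- The defining ideal of an arrangement with defining polynomials `p i`: the principal ideal of
`K[x, y]` generated by the product of the `p i`. -/
noncomputable def arrangementIdeal {K : Type*} [Field K] {r : ℕ} (p : Fin r → MvPolynomial (Fin 2) K) :
    Ideal (MvPolynomial (Fin 2) K) :=
  Ideal.span {∏ i, p i}

instance arrangementIdeal_isPrincipal {K : Type*} [Field K] {r : ℕ}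
    (p : Fin r → MvPolynomial (Fin 2) K) : (arrangementIdeal p).IsPrincipal :=
  ⟨⟨∏ i, p i, rfl⟩⟩

end DiffOp

/-!
Let `S = K[x, y]` and let `A = S / I` be the coordinate ring of the arrangement.

*The isomorphism.* A differential operator preserving `I` induces one on `A` (`toQuotient`). If it
induces zero then it has values in `I = Q S`, so it can be divided by `Q` and lies in `I D(S)`
(`mem_idealMul_of_forall_apply_mem`). Conversely, every differential operator from `S` to a quotient
`R` lifts to `S` (`exists_ring_lift`): by induction on the order, the commutator of the given operator
`φ` with a variable lifts, this lift is the commutator of the variable with some differential operator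
(integrate with respect to the partial derivative, in characteristic zero), and subtracting that
operator makes `φ` commute with the variable. An operator commuting with all variables is a
multiplication.

*The Noetherian property.* Restriction to the `i`-th line is a map `S → K[X]` with kernel `(p i)`, and
multiplication by `q i = ∏_{j ≠ i} p j` factors through an `S`-linear embedding of `K[X]` into `A`, whose
image is the ideal of functions vanishing on the other lines. Differential operators are local
(`IsDiffOp.exists_pow_mul_eq_zero`), so every `θ` in `D(A)` preserves these ideals. This embeds `D(A)`
into the product `W` of `r` copies of the first Weyl algebra `D(K[X])` (`Branches.toProd`). If `c` is
the element of `W` whose components are the restrictions of the `q i`, that is, nonzero scalar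
multiples of `X ^ (r - 1)`, then `D(A)` contains `W c` (`Branches.mul_conductor_mem_range`), and `W c`
has finite codimension in `D(A)` (`Branches.exists_finite_obstruction`).

The algebra `W` is left and right Noetherian (`isNoetherianRing_of_weyl`), and on a Noetherian
`W`-module the kernel of `c` is finite-dimensional (`fg_ker_act`), because the submodule generated by
the kernel of `X` is the direct sum of the translates of the kernel under the powers of the derivative.
This is what is needed to pass from `W` to `D(A)`. For a left ideal `Y` of `D(A)`, the `W`-module
`W c Y` lies in a finitely generated part of `Y`, and `Y / W c Y` lies in the kernel of `c` on
`W / W c Y`. For a right ideal `Y`, the same holds of `Y W c`, and `(Y W ∩ W c) / Y W c` is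
isomorphic to the kernel of `c` acting on `W / Y W` from the right.
-/

namespace DiffOp

/-! ### Algebras generated by `x` and `d` with `d x - x d = 1` -/

section Weyl

variable {C W : Type*} [CommRing C] [Ring W] [Algebra C W]

/-- The left `C[x]`-span of `1, d, …, d ^ (n - 1)` in a `C`-algebra `W` with elements `x` and `d`. -/
def lowOrder (x d : W) (n : ℕ) : Submodule C W :=
  Submodule.span C {w | ∃ f : Polynomial C, ∃ j < n, w = Polynomial.aeval x f * d ^ j}

variable {x d : W}

theorem lowOrder_mono : Monotone (lowOrder (C := C) x d) := fun _ _ h =>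
  Submodule.span_mono fun _ ⟨f, j, hj, e⟩ => ⟨f, j, hj.trans_le h, e⟩

theorem aeval_mul_pow_mem_lowOrder (f : Polynomial C) {j n : ℕ} (h : j < n) :
    Polynomial.aeval x f * d ^ j ∈ lowOrder (C := C) x d n :=
  Submodule.subset_span ⟨f, j, h, rfl⟩

theorem aeval_mul_mem_lowOrder (f : Polynomial C) {n : ℕ} {w : W}
    (hw : w ∈ lowOrder (C := C) x d n) : Polynomial.aeval x f * w ∈ lowOrder (C := C) x d n := by
  induction hw using Submodule.span_induction with
  | mem w hw =>
    obtain ⟨g, j, hj, rfl⟩ := hw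
    rw [← mul_assoc, ← map_mul]
    exact aeval_mul_pow_mem_lowOrder _ hj
  | zero => rw [mul_zero]; exact Submodule.zero_mem _
  | add a b _ _ ha hb => rw [mul_add]; exact Submodule.add_mem _ ha hb
  | smul c a _ ha => rw [mul_smul_comm]; exact Submodule.smul_mem _ c ha

theorem exists_of_mem_lowOrder_succ {n : ℕ} {w : W} (hw : w ∈ lowOrder (C := C) x d (n + 1)) :
    ∃ f : Polynomial C, w - Polynomial.aeval x f * d ^ n ∈ lowOrder (C := C) x d n := by
  induction hw using Submodule.span_induction with
  | mem w hw =>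
    obtain ⟨f, j, hj, rfl⟩ := hw
    rcases Nat.lt_succ_iff_lt_or_eq.1 hj with hj | rfl
    · exact ⟨0, by simpa using aeval_mul_pow_mem_lowOrder f hj⟩
    · exact ⟨f, by simp⟩
  | zero => exact ⟨0, by simp⟩
  | add a b _ _ ha hb =>
    obtain ⟨f, hf⟩ := ha
    obtain ⟨g, hg⟩ := hb
    refine ⟨f + g, ?_⟩
    convert Submodule.add_mem _ hf hg using 1
    rw [map_add, add_mul]
    abel
  | smul c a _ ha =>
    obtain ⟨f, hf⟩ := ha
    refine ⟨c • f, ?_⟩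
    convert Submodule.smul_mem _ c hf using 1
    rw [map_smul, smul_mul_assoc, smul_sub]

theorem mul_aeval_of_commutator (h : d * x = x * d + 1) (f : Polynomial C) :
    d * Polynomial.aeval x f =
      Polynomial.aeval x f * d + Polynomial.aeval x (Polynomial.derivative f) := by
  induction f using Polynomial.induction_on' with
  | add f g hf hg => simp only [map_add, mul_add, add_mul, hf, hg]; abel
  | monomial n a =>
    induction n with
    | zero => simp [Algebra.commutes]
    | succ n ih =>
      rw [← Polynomial.monomial_mul_X, map_mul, Polynomial.aeval_X, ← mul_assoc, ih,
        Polynomial.derivative_mul, Polynomial.derivative_X, mul_one, map_add, map_mul,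
        Polynomial.aeval_X, add_mul, mul_assoc _ d x, h, mul_add, mul_one, mul_assoc]
      abel

theorem mul_mem_lowOrder (h : d * x = x * d + 1) {n : ℕ} {w : W}
    (hw : w ∈ lowOrder (C := C) x d n) : d * w ∈ lowOrder (C := C) x d (n + 1) := by
  induction hw using Submodule.span_induction with
  | mem w hw =>
    obtain ⟨f, j, hj, rfl⟩ := hw
    rw [← mul_assoc, mul_aeval_of_commutator h, add_mul, mul_assoc, ← pow_succ']
    exact Submodule.add_mem _ (aeval_mul_pow_mem_lowOrder _ (by omega))
      (aeval_mul_pow_mem_lowOrder _ (by omega))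
  | zero => rw [mul_zero]; exact Submodule.zero_mem _
  | add a b _ _ ha hb => rw [mul_add]; exact Submodule.add_mem _ ha hb
  | smul c a _ ha => rw [mul_smul_comm]; exact Submodule.smul_mem _ c ha

theorem exists_mem_lowOrder (h : d * x = x * d + 1) (hgen : Algebra.adjoin C {x, d} = ⊤) (w : W) :
    ∃ n, w ∈ lowOrder (C := C) x d n := by
  have hw : w ∈ Algebra.adjoin C {x, d} := hgen ▸ Algebra.mem_top
  suffices H : ∀ n, ∀ v ∈ lowOrder (C := C) x d n, ∃ m, w * v ∈ lowOrder (C := C) x d m by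
    obtain ⟨m, hm⟩ := H 1 1 (by
      simpa using aeval_mul_pow_mem_lowOrder (x := x) (d := d) (1 : Polynomial C) zero_lt_one)
    exact ⟨m, by simpa using hm⟩
  induction hw using Algebra.adjoin_induction with
  | mem w hw =>
    intro n v hv
    rcases hw with rfl | rfl
    · exact ⟨n, by simpa using aeval_mul_mem_lowOrder Polynomial.X hv⟩
    · exact ⟨n + 1, mul_mem_lowOrder h hv⟩
  | algebraMap c =>
    intro n v hv
    exact ⟨n, by rw [← Algebra.smul_def]; exact Submodule.smul_mem _ c hv⟩
  | add a b _ _ ha hb =>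
    intro n v hv
    obtain ⟨k, hk⟩ := ha n v hv
    obtain ⟨l, hl⟩ := hb n v hv
    exact ⟨max k l, by
      rw [add_mul]
      exact Submodule.add_mem _ (lowOrder_mono (le_max_left k l) hk)
        (lowOrder_mono (le_max_right k l) hl)⟩
  | mul a b _ _ ha hb =>
    intro n v hv
    obtain ⟨k, hk⟩ := hb n v hv
    obtain ⟨l, hl⟩ := ha k _ hk
    exact ⟨l, by rwa [mul_assoc]⟩

/-- The ideal of leading coefficients of the elements of order at most `n` of a left ideal. -/
def leadingIdeal (x d : W) (I : Ideal W) (n : ℕ) : Ideal (Polynomial C) where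
  carrier := {f | ∃ w ∈ lowOrder (C := C) x d n, Polynomial.aeval x f * d ^ n + w ∈ I}
  zero_mem' := ⟨0, Submodule.zero_mem _, by simp⟩
  add_mem' := fun {f g} ⟨v, hv, hfv⟩ ⟨w, hw, hgw⟩ => ⟨v + w, Submodule.add_mem _ hv hw, by
    convert I.add_mem hfv hgw using 1
    rw [map_add, add_mul]
    abel⟩
  smul_mem' := fun g f ⟨v, hv, hfv⟩ => ⟨Polynomial.aeval x g * v, aeval_mul_mem_lowOrder g hv, by
    convert I.mul_mem_left (Polynomial.aeval x g) hfv using 1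
    rw [smul_eq_mul, map_mul, mul_add, mul_assoc]⟩

theorem leadingIdeal_mono_left {I J : Ideal W} (h : I ≤ J) (n : ℕ) :
    leadingIdeal (C := C) x d I n ≤ leadingIdeal (C := C) x d J n :=
  fun _ ⟨w, hw, hfw⟩ => ⟨w, hw, h hfw⟩

theorem leadingIdeal_monotone (h : d * x = x * d + 1) (I : Ideal W) :
    Monotone (leadingIdeal (C := C) x d I) := by
  refine monotone_nat_of_le_succ fun n f ⟨w, hw, hfw⟩ => ?_
  refine ⟨Polynomial.aeval x (Polynomial.derivative f) * d ^ n + d * w,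
    Submodule.add_mem _ (aeval_mul_pow_mem_lowOrder _ n.lt_succ_self) (mul_mem_lowOrder h hw), ?_⟩
  convert I.mul_mem_left d hfw using 1
  rw [mul_add, ← mul_assoc, mul_aeval_of_commutator h, add_mul, mul_assoc _ d, ← pow_succ',
    add_assoc]

theorem le_of_leadingIdeal_le (h : d * x = x * d + 1) (hgen : Algebra.adjoin C {x, d} = ⊤)
    {I J : Ideal W} (hIJ : I ≤ J)
    (hl : ∀ n, leadingIdeal (C := C) x d J n ≤ leadingIdeal (C := C) x d I n) : J ≤ I := by
  have key : ∀ n, ∀ w ∈ lowOrder (C := C) x d n, w ∈ J → w ∈ I := by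
    intro n
    induction n with
    | zero =>
      intro w hw _
      have : w = 0 := by simpa [lowOrder] using hw
      rw [this]
      exact I.zero_mem
    | succ n ih =>
      intro w hw hwJ
      obtain ⟨f, hf⟩ := exists_of_mem_lowOrder_succ hw
      obtain ⟨v, hv, hfv⟩ := hl n (show f ∈ leadingIdeal x d J n from ⟨_, hf, by simpa using hwJ⟩)
      have hd := ih (w - (Polynomial.aeval x f * d ^ n + v))
        (by rw [← sub_sub]; exact Submodule.sub_mem _ hf hv) (J.sub_mem hwJ (hIJ hfv))
      simpa using I.add_mem hd hfv
  intro w hw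
  obtain ⟨n, hn⟩ := exists_mem_lowOrder h hgen w
  exact key n w hn hw

/-- A Hilbert basis theorem: an algebra over a Noetherian ring `C` that is generated by two
elements satisfying the Weyl relation `d x - x d = 1` is left Noetherian. -/
theorem isNoetherianRing_of_weyl [IsNoetherianRing C] (h : d * x = x * d + 1)
    (hgen : Algebra.adjoin C {x, d} = ⊤) : IsNoetherianRing W := by
  refine monotone_stabilizes_iff_noetherian.1 fun F => ?_
  have stab : ∀ G : ℕ →o Ideal (Polynomial C), ∃ n, ∀ m, n ≤ m → G n = G m :=
    monotone_stabilizes_iff_noetherian.2 inferInstance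
  obtain ⟨k, hk⟩ := stab ⟨fun n => leadingIdeal x d (F n) n, fun a b hab =>
    (leadingIdeal_monotone h _ hab).trans (leadingIdeal_mono_left (F.monotone hab) b)⟩
  choose s hs using fun n => stab ⟨fun j => leadingIdeal x d (F j) n, fun a b hab =>
    leadingIdeal_mono_left (F.monotone hab) n⟩
  -- the diagonal takes care of orders `n ≥ k`, finitely many further chains of orders `n < k`
  replace hk : ∀ m, k ≤ m → leadingIdeal (C := C) x d (F k) k = leadingIdeal x d (F m) m := hk
  replace hs : ∀ n m, s n ≤ m →
      leadingIdeal (C := C) x d (F (s n)) n = leadingIdeal x d (F m) n := hs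
  obtain ⟨M, hkM, hsM⟩ : ∃ M, k ≤ M ∧ ∀ n < k, s n ≤ M :=
    ⟨max k ((Finset.range k).sup s), le_max_left _ _, fun n hn =>
      (Finset.le_sup (Finset.mem_range.2 hn)).trans (le_max_right _ _)⟩
  refine ⟨M, fun m hm => le_antisymm (F.monotone hm)
    (le_of_leadingIdeal_le h hgen (F.monotone hm) fun n => ?_)⟩
  rcases lt_or_ge n k with hn | hn
  · rw [← hs n m ((hsM n hn).trans hm), hs n M (hsM n hn)]
  · -- both ideals lie between the two equal diagonal ones of index `k` and `max n m`
    calc leadingIdeal x d (F m) n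
        ≤ leadingIdeal x d (F (max n m)) (max n m) :=
          (leadingIdeal_monotone h _ (le_max_left n m)).trans
            (leadingIdeal_mono_left (F.monotone (le_max_right n m)) _)
      _ = leadingIdeal x d (F k) k := (hk _ (hn.trans (le_max_left n m))).symm
      _ ≤ leadingIdeal x d (F M) n :=
          (leadingIdeal_monotone h _ hn).trans (leadingIdeal_mono_left (F.monotone hkM) n)

variable {M : Type*} [AddCommGroup M] [Module W M] [Module C M] [IsScalarTower C W M]

theorem smul_pow_smul_of_smul_eq_zero (h : d * x = x * d + 1) {v : M} (hv : x • v = 0) (k : ℕ) :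
    x • d ^ (k + 1) • v = -((k + 1) • d ^ k • v) := by
  have hd : ∀ u : M, x • d • u = d • x • u - u := by
    intro u
    rw [smul_smul, smul_smul, h, add_smul, one_smul, add_sub_cancel_right]
  induction k with
  | zero => simp [hd, hv]
  | succ k ih =>
    rw [pow_succ', mul_smul, hd, ih, smul_neg, smul_comm d (k + 1), smul_smul, ← pow_succ',
      succ_nsmul (d ^ (k + 1) • v) (k + 1)]
    abel

/-- The powers `d ^ k` are independent over the kernel of `x`. -/
theorem eq_zero_of_sum_pow_smul_eq_zero [IsAddTorsionFree M] (h : d * x = x * d + 1) (n : ℕ) :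
    ∀ v : ℕ → M, (∀ k, x • v k = 0) → ∑ k ∈ Finset.range n, d ^ k • v k = 0 →
      ∀ k < n, v k = 0 := by
  induction n with
  | zero => intro v _ _ k hk; omega
  | succ n ih =>
    intro v hv hs
    have hpos : ∀ k < n, v (k + 1) = 0 := by
      have h1 := congrArg (x • ·) hs
      simp only [Finset.sum_range_succ', smul_add, smul_zero, pow_zero, one_smul, hv, add_zero,
        Finset.smul_sum, smul_pow_smul_of_smul_eq_zero h (hv _), Finset.sum_neg_distrib,
        neg_eq_zero] at h1
      have h2 := ih (fun k => (k + 1) • v (k + 1))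
        (fun k => by rw [smul_comm, hv, smul_zero]) (by simpa only [smul_comm (d ^ _)] using h1)
      exact fun k hk => (smul_eq_zero_iff_right (Nat.succ_ne_zero k)).1 (h2 k hk)
    intro k hk
    cases k with
    | succ k => exact hpos k (by omega)
    | zero =>
      rw [Finset.sum_range_succ', Finset.sum_eq_zero fun k hk => by
        rw [hpos k (Finset.mem_range.1 hk), smul_zero]] at hs
      simpa using hs

/-- The action of `w` as a `C`-linear endomorphism. -/
abbrev act (C : Type*) {W : Type*} [CommRing C] [Ring W] [Algebra C W] (M : Type*)
    [AddCommGroup M] [Module W M] [Module C M] [IsScalarTower C W M] (w : W) : Module.End C M :=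
  Algebra.lsmul C C M w

/-- The `W`-submodule generated by a subspace of the kernel of `x` consists of the sums of translates
of that subspace under the powers of `d`. -/
theorem exists_sum_of_mem_span (h : d * x = x * d + 1) (hgen : Algebra.adjoin C {x, d} = ⊤)
    {V : Submodule C M} (hV : ∀ v ∈ V, x • v = 0) {u : M} (hu : u ∈ Submodule.span W (V : Set M)) :
    ∃ n, ∃ v : ℕ → M, (∀ k, v k ∈ V) ∧ u = ∑ k ∈ Finset.range n, d ^ k • v k := by
  let G : Submodule C M := ⨆ k : ℕ, V.map (act C M (d ^ k))
  have hmem : ∀ k, ∀ v ∈ V, d ^ k • v ∈ G := fun k v hv =>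
    Submodule.mem_iSup_of_mem k ⟨v, hv, rfl⟩
  have hstab : ∀ w : W, (∀ k, ∀ v ∈ V, w • d ^ k • v ∈ G) → ∀ u ∈ G, w • u ∈ G := by
    intro w hw
    have : G ≤ G.comap (act C M w) := iSup_le fun k => by
      rintro _ ⟨v, hv, rfl⟩
      exact hw k v hv
    exact this
  have hG : ∀ w : W, ∀ u ∈ G, w • u ∈ G := by
    intro w
    have hw : w ∈ Algebra.adjoin C {x, d} := hgen ▸ Algebra.mem_top
    induction hw using Algebra.adjoin_induction with
    | mem w hw =>
      refine hstab w fun k v hv => ?_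
      rcases hw with rfl | rfl
      · cases k with
        | zero => simp [hV v hv]
        | succ k =>
          rw [smul_pow_smul_of_smul_eq_zero h (hV v hv)]
          exact G.neg_mem (nsmul_mem (hmem k v hv) _)
      · rw [smul_smul, ← pow_succ']
        exact hmem _ v hv
    | algebraMap c => intro u hu; rw [algebraMap_smul]; exact G.smul_mem c hu
    | add a b _ _ ha hb => intro u hu; rw [add_smul]; exact G.add_mem (ha u hu) (hb u hu)
    | mul a b _ _ ha hb => intro u hu; rw [mul_smul]; exact ha _ (hb u hu)
  have huG : u ∈ G := by
    induction hu using Submodule.span_induction with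
    | mem u hu => simpa using hmem 0 u hu
    | zero => exact G.zero_mem
    | add a b _ _ ha hb => exact G.add_mem ha hb
    | smul w a _ ha => exact hG w a ha
  obtain ⟨f, hf, rfl⟩ := (Submodule.mem_iSup_iff_exists_finsupp _ _).1 huG
  choose v hv hvf using hf
  obtain ⟨n, hn⟩ := f.support.exists_nat_subset_range
  refine ⟨n, v, hv, ?_⟩
  rw [Finsupp.sum_of_support_subset f hn _ (by simp)]
  exact Finset.sum_congr rfl fun k _ => (hvf k).symm

/-- On a Noetherian module over an algebra generated by `x` and `d` with `d x - x d = 1`, the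
kernel of `x` is finitely generated over the base ring: the submodule it generates is the direct sum
of its translates by the powers of `d`. -/
theorem fg_ker_act [IsAddTorsionFree M] [IsNoetherian W M] (h : d * x = x * d + 1)
    (hgen : Algebra.adjoin C {x, d} = ⊤) : (LinearMap.ker (act C M x)).FG := by
  obtain ⟨s, hs, hspan⟩ := Submodule.fg_span_iff_fg_span_finset_subset
    (LinearMap.ker (act C M x) : Set M) |>.1 (IsNoetherian.noetherian
      (Submodule.span W (LinearMap.ker (act C M x) : Set M)))
  refine ⟨s, le_antisymm (Submodule.span_le.2 hs) fun u hu => ?_⟩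
  have hV : ∀ v ∈ Submodule.span C (s : Set M), x • v = 0 := fun v hv =>
    (Submodule.span_le.2 hs : Submodule.span C (s : Set M) ≤ LinearMap.ker (act C M x)) hv
  have hu' : u ∈ Submodule.span W (Submodule.span C (s : Set M) : Set M) :=
    Submodule.span_mono Submodule.subset_span (hspan ▸ Submodule.subset_span hu)
  obtain ⟨n, v, hv, e⟩ := exists_sum_of_mem_span h hgen hV hu'
  cases n with
  | zero => rw [e]; simp
  | succ n =>
    -- move `u` into the coefficient of `d ^ 0`
    have h0 := eq_zero_of_sum_pow_smul_eq_zero h (n + 1) (fun k => if k = 0 then v 0 - u else v k)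
      (fun k => by
        split_ifs
        · rw [smul_sub, hV _ (hv 0), show x • u = 0 from hu, sub_zero]
        · exact hV _ (hv k))
      (by
        rw [Finset.sum_range_succ'] at e ⊢
        simp only [Nat.add_eq_zero_iff, one_ne_zero, and_false, if_false, if_true, smul_sub]
        rw [← add_sub_assoc, ← e]
        simp)
      0 n.succ_pos
    rw [if_pos rfl, sub_eq_zero] at h0
    exact h0 ▸ hv 0

theorem fg_ker_act_pow [IsNoetherianRing C] [IsAddTorsionFree M] [IsNoetherian W M]
    (h : d * x = x * d + 1) (hgen : Algebra.adjoin C {x, d} = ⊤) (n : ℕ) :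
    (LinearMap.ker (act C M (x ^ n))).FG := by
  induction n with
  | zero =>
    have : LinearMap.ker (act C M (x ^ 0)) = ⊥ := by
      ext u
      simp
    rw [this]
    exact Submodule.fg_bot
  | succ n ih =>
    refine Submodule.fg_of_fg_map_of_fg_inf_ker (act C M x) ?_ ?_
    · have := isNoetherian_of_fg_of_noetherian _ ih
      refine Submodule.FG.of_le ih ?_
      rintro _ ⟨u, hu, rfl⟩
      have hu' : x ^ (n + 1) • u = 0 := hu
      change x ^ n • x • u = 0
      rwa [smul_smul, ← pow_succ]
    · exact Submodule.FG.of_le (fg_ker_act h hgen) inf_le_right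

end Weyl

/-! ### Subrings of Noetherian rings -/

section Sandwich

theorem exists_finset_le_span_sup_ker {K V U : Type*} [Ring K] [AddCommGroup V] [Module K V]
    [AddCommGroup U] [Module K U] (f : V →ₗ[K] U) {A : Submodule K V} (h : (A.map f).FG) :
    ∃ s : Finset V, (s : Set V) ⊆ A ∧ A ≤ Submodule.span K s ⊔ LinearMap.ker f := by
  classical
  obtain ⟨t, ht, e⟩ := (Submodule.fg_span_iff_fg_span_finset_subset (R := K) (f '' A)).1 (by
    rwa [Submodule.span_image, Submodule.span_eq])
  obtain ⟨s, hs, rfl⟩ := Finset.subset_set_image_iff.1 ht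
  refine ⟨s, hs, ?_⟩
  rw [← Submodule.comap_map_eq, Submodule.map_span, ← Finset.coe_image, ← e]
  exact fun a ha => Submodule.subset_span ⟨a, ha, rfl⟩

variable {K T W : Type*} [Field K] [Ring T] [Ring W] [Algebra K T] [Algebra K W]

/-- The image in `W` of the left ideal of `T` generated by `s`. -/
abbrev imageIdeal (ι : T →ₐ[K] W) (s : Set T) : Submodule K W :=
  ((Ideal.span s).restrictScalars K).map ι.toLinearMap

theorem mul_mem_imageIdeal {ι : T →ₐ[K] W} {s : Set T} {w : W} (hw : w ∈ ι.range) {y : T}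
    (hy : y ∈ s) : w * ι y ∈ imageIdeal ι s := by
  obtain ⟨t, rfl⟩ := hw
  exact ⟨t * y, Ideal.mul_mem_left _ t (Ideal.subset_span hy), map_mul ι t y⟩

theorem mem_of_mem_imageIdeal {ι : T →ₐ[K] W} (hι : Function.Injective ι) {s : Set T} {y : T}
    (hy : ι y ∈ imageIdeal ι s) : y ∈ Ideal.span s := by
  obtain ⟨z, hz, e⟩ := hy
  rwa [← hι e]

/-- A subring of a left Noetherian ring `W` that contains `W c` is left Noetherian, if `c` has
finite-dimensional kernel on every cyclic `W`-module. For a left ideal `Y` of the subring, the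
`W`-module `W c Y` lies in a finitely generated part of `Y`, and `Y / W c Y` is killed by `c`. -/
theorem isNoetherianRing_of_mul_right_mem_range [IsNoetherianRing W] (ι : T →ₐ[K] W)
    (hι : Function.Injective ι) (c : W) (hc : ∀ w, w * c ∈ ι.range)
    (hker : ∀ Z : Ideal W, (LinearMap.ker (act K (W ⧸ Z) c)).FG) : IsNoetherianRing T := by
  classical
  refine (isNoetherianRing_iff_ideal_fg T).2 fun Y => ?_
  obtain ⟨t, ht, hZ⟩ := (Submodule.fg_span_iff_fg_span_finset_subset (R := W)
    ((fun y => c * ι y) '' (Y : Set T))).1 (IsNoetherian.noetherian _)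
  obtain ⟨s, hs, rfl⟩ := Finset.subset_set_image_iff.1 ht
  set Z : Ideal W := Submodule.span W ((fun y => c * ι y) '' (Y : Set T)) with hZdef
  have hZY : ∀ z ∈ Z, z ∈ imageIdeal ι s := by
    intro z hz
    rw [hZ] at hz
    induction hz using Submodule.closure_induction with
    | zero => exact Submodule.zero_mem _
    | add a b _ _ ha hb => exact Submodule.add_mem _ ha hb
    | smul_mem w z hz =>
      obtain ⟨y, hy, rfl⟩ := Finset.mem_image.1 (Finset.mem_coe.1 hz)
      rw [smul_eq_mul, ← mul_assoc]
      exact mul_mem_imageIdeal (hc w) hy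
  obtain ⟨s', hs', hle⟩ := exists_finset_le_span_sup_ker
    ((Z.mkQ.restrictScalars K).comp ι.toLinearMap) (A := Y.restrictScalars K)
    ((hker Z).of_le (by
      rintro _ ⟨y, hy, rfl⟩
      exact (Submodule.Quotient.mk_eq_zero Z).2 (Submodule.subset_span ⟨y, hy, rfl⟩)))
  refine ⟨s ∪ s', le_antisymm (Ideal.span_le.2 (by simpa using ⟨hs, hs'⟩)) fun y hy => ?_⟩
  obtain ⟨a, ha, b, hb, rfl⟩ := Submodule.mem_sup.1 (hle hy)
  refine Ideal.add_mem _ ?_ ?_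
  · exact Submodule.span_le_restrictScalars K T _ (Submodule.span_mono (by simp) ha)
  · exact Ideal.span_mono (by simp) (mem_of_mem_imageIdeal hι
      (hZY _ ((Submodule.Quotient.mk_eq_zero Z).1 hb)))

/-- A subring of a left Noetherian ring `W` that contains `c W` with finite codimension, as witnessed by
the map `ψ`, is left Noetherian if `c` has finite-dimensional kernel on every cyclic `W`-module. For a left ideal `Y` of
the subring, `c W Y` lies in a finitely generated part of `Y`, and the quotient of `Y ∩ c W` by
`c W Y` is controlled by the kernel of `c` on `W / W Y`. -/
theorem isNoetherianRing_of_mul_left_mem_range [IsNoetherianRing W] (ι : T →ₐ[K] W)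
    (hι : Function.Injective ι) (c : W) (hc : ∀ w, c * w ∈ ι.range)
    (hker : ∀ Z : Ideal W, (LinearMap.ker (act K (W ⧸ Z) c)).FG)
    {V : Type*} [AddCommGroup V] [Module K V] [FiniteDimensional K V] (ψ : T →ₗ[K] V)
    (hψ : ∀ t, ψ t = 0 → ∃ w, ι t = c * w) : IsNoetherianRing T := by
  classical
  refine (isNoetherianRing_iff_ideal_fg T).2 fun Y => ?_
  obtain ⟨t, ht, hZ⟩ := (Submodule.fg_span_iff_fg_span_finset_subset (R := W)
    (ι '' (Y : Set T))).1 (IsNoetherian.noetherian _)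
  obtain ⟨s, hs, rfl⟩ := Finset.subset_set_image_iff.1 ht
  set Z : Ideal W := Submodule.span W (ι '' (Y : Set T)) with hZdef
  have hZY : ∀ z ∈ Z, c * z ∈ imageIdeal ι s := by
    intro z hz
    rw [hZ] at hz
    induction hz using Submodule.closure_induction with
    | zero => rw [mul_zero]; exact Submodule.zero_mem _
    | add a b _ _ ha hb => rw [mul_add]; exact Submodule.add_mem _ ha hb
    | smul_mem w z hz =>
      obtain ⟨y, hy, rfl⟩ := Finset.mem_image.1 (Finset.mem_coe.1 hz)
      rw [smul_eq_mul, ← mul_assoc]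
      exact mul_mem_imageIdeal (hc w) hy
  obtain ⟨s₁, hs₁, hle₁⟩ := exists_finset_le_span_sup_ker (Z.mkQ.restrictScalars K)
    (A := ((Y.restrictScalars K).map ι.toLinearMap).comap (LinearMap.mulLeft K c))
    ((hker Z).of_le (by
      rintro _ ⟨w, ⟨y, hy, e⟩, rfl⟩
      refine (Submodule.Quotient.mk_eq_zero Z).2 ?_
      change c * w ∈ Z
      rw [← show ι y = c * w from e]
      exact Submodule.subset_span ⟨y, hy, rfl⟩))
  choose! g hgY hg using fun w (hw : w ∈ s₁) => hs₁ hw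
  obtain ⟨s₂, hs₂, hle₂⟩ := exists_finset_le_span_sup_ker ψ (A := Y.restrictScalars K)
    (IsNoetherian.noetherian _)
  have hs₁Y : (s₁.image g : Set T) ⊆ Y := by
    intro y hy
    obtain ⟨w, hw, rfl⟩ := Finset.mem_image.1 (Finset.mem_coe.1 hy)
    exact hgY w hw
  refine ⟨s ∪ s₁.image g ∪ s₂, le_antisymm (Ideal.span_le.2 (by
    rw [Finset.coe_union, Finset.coe_union]
    exact Set.union_subset (Set.union_subset hs hs₁Y) hs₂)) fun y hy => ?_⟩
  obtain ⟨a, ha, b, hb, rfl⟩ := Submodule.mem_sup.1 (hle₂ hy)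
  have haY : a ∈ Y := Submodule.span_le.2 hs₂ ha
  have hbY : b ∈ Y := (Submodule.add_mem_iff_right Y haY).1 hy
  refine Ideal.add_mem _ (Submodule.span_le_restrictScalars K T _
    (Submodule.span_mono (by rw [Finset.coe_union]; exact Set.subset_union_right) ha)) ?_
  obtain ⟨w, hw⟩ := hψ b hb
  obtain ⟨w₁, hw₁, z, hz, rfl⟩ := Submodule.mem_sup.1 (hle₁ (x := w) ⟨b, hbY, hw⟩)
  have hcz := hZY z ((Submodule.Quotient.mk_eq_zero Z).1 hz)
  have hcw₁ : c * w₁ ∈ imageIdeal ι (s₁.image g : Set T) := by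
    have hle : Submodule.span K (s₁ : Set W) ≤
        (imageIdeal ι (s₁.image g : Set T)).comap (LinearMap.mulLeft K c) :=
      Submodule.span_le.2 fun v hv =>
        ⟨g v, Ideal.subset_span (Finset.mem_image_of_mem g hv), hg v hv⟩
    exact hle hw₁
  obtain ⟨y₁, hy₁, e₁⟩ := hcw₁
  obtain ⟨y₂, hy₂, e₂⟩ := hcz
  have e : b = y₁ + y₂ := hι (by
    rw [hw, mul_add, map_add]
    exact congrArg₂ (· + ·) e₁.symm e₂.symm)
  rw [e]
  refine Ideal.add_mem _ (Ideal.span_mono ?_ hy₁) (Ideal.span_mono ?_ hy₂) <;>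
    intro v hv <;> simp_all

end Sandwich

/-! ### Differential operators between algebras -/

section Between

variable {K S R R' R'' : Type*} [CommRing K] [CommRing S] [CommRing R] [CommRing R'] [CommRing R'']
  [Algebra K S] [Algebra K R] [Algebra K R'] [Algebra K R'']

/-- The commutator `φ ↦ φ s - s φ` on `K`-linear maps between two `S`-algebras, where `s` acts
through the structure maps `f` and `g`. -/
def commutator (f : S →ₐ[K] R) (g : S →ₐ[K] R') (s : S) : (R →ₗ[K] R') →ₗ[K] (R →ₗ[K] R') where
  toFun φ := φ ∘ₗ LinearMap.mulLeft K (f s) - LinearMap.mulLeft K (g s) ∘ₗ φ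
  map_add' φ ψ := by rw [LinearMap.add_comp, LinearMap.comp_add]; abel
  map_smul' c φ := by
    ext x
    simp [smul_sub]

theorem commutator_apply (f : S →ₐ[K] R) (g : S →ₐ[K] R') (s : S) (φ : R →ₗ[K] R') (x : R) :
    commutator f g s φ x = φ (f s * x) - g s * φ x := rfl

/-- The `S`-differential operators of order less than `m` between two `S`-algebras, the algebra
structures being given by `f` and `g`. The shift by one makes `m = 0` the zero operator. -/
def diffBetween (f : S →ₐ[K] R) (g : S →ₐ[K] R') : ℕ → Submodule K (R →ₗ[K] R')
  | 0 => ⊥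
  | m + 1 => ⨅ s, (diffBetween f g m).comap (commutator f g s)

variable {f : S →ₐ[K] R} {g : S →ₐ[K] R'} {h : S →ₐ[K] R''}

theorem mem_diffBetween_zero {φ : R →ₗ[K] R'} : φ ∈ diffBetween f g 0 ↔ φ = 0 := Iff.rfl

theorem mem_diffBetween_succ {m : ℕ} {φ : R →ₗ[K] R'} :
    φ ∈ diffBetween f g (m + 1) ↔ ∀ s, commutator f g s φ ∈ diffBetween f g m := by
  simp [diffBetween]

theorem diffBetween_monotone : Monotone (diffBetween f g) := by
  refine monotone_nat_of_le_succ fun m => ?_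
  induction m with
  | zero => exact bot_le
  | succ m ih =>
    intro φ hφ
    rw [mem_diffBetween_succ] at hφ ⊢
    exact fun s => ih (hφ s)

/-- `φ` is a differential operator between two `S`-algebras. -/
def IsDiffOp (f : S →ₐ[K] R) (g : S →ₐ[K] R') (φ : R →ₗ[K] R') : Prop :=
  ∃ m, φ ∈ diffBetween f g m

theorem IsDiffOp.sub {φ ψ : R →ₗ[K] R'} (hφ : IsDiffOp f g φ) (hψ : IsDiffOp f g ψ) :
    IsDiffOp f g (φ - ψ) := by
  obtain ⟨m, hm⟩ := hφ
  obtain ⟨n, hn⟩ := hψ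
  exact ⟨max m n, Submodule.sub_mem _ (diffBetween_monotone (le_max_left m n) hm)
    (diffBetween_monotone (le_max_right m n) hn)⟩

theorem commutator_comp_left {σ : R' →ₗ[K] R''} (hσ : ∀ s x, σ (g s * x) = h s * σ x) (s : S)
    (φ : R →ₗ[K] R') : commutator f h s (σ ∘ₗ φ) = σ ∘ₗ commutator f g s φ := by
  ext x
  simp [commutator_apply, hσ]

theorem commutator_comp_right {π : R →ₗ[K] R'} (hπ : ∀ s x, π (f s * x) = g s * π x) (s : S)
    (φ : R' →ₗ[K] R'') : commutator f h s (φ ∘ₗ π) = commutator g h s φ ∘ₗ π := by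
  ext x
  simp [commutator_apply, hπ]

theorem IsDiffOp.comp_left {σ : R' →ₗ[K] R''} (hσ : ∀ s x, σ (g s * x) = h s * σ x)
    {φ : R →ₗ[K] R'} (hφ : IsDiffOp f g φ) : IsDiffOp f h (σ ∘ₗ φ) := by
  obtain ⟨m, hm⟩ := hφ
  refine ⟨m, ?_⟩
  induction m generalizing φ with
  | zero => rw [mem_diffBetween_zero] at *; rw [hm, LinearMap.comp_zero]
  | succ m ih =>
    rw [mem_diffBetween_succ] at *
    exact fun s => commutator_comp_left hσ s φ ▸ ih (hm s)

theorem IsDiffOp.comp_right {π : R →ₗ[K] R'} (hπ : ∀ s x, π (f s * x) = g s * π x)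
    {φ : R' →ₗ[K] R''} (hφ : IsDiffOp g h φ) : IsDiffOp f h (φ ∘ₗ π) := by
  obtain ⟨m, hm⟩ := hφ
  refine ⟨m, ?_⟩
  induction m generalizing φ with
  | zero => rw [mem_diffBetween_zero] at *; rw [hm, LinearMap.zero_comp]
  | succ m ih =>
    rw [mem_diffBetween_succ] at *
    exact fun s => commutator_comp_right hπ s φ ▸ ih (hm s)

theorem IsDiffOp.of_comp_left {σ : R' →ₗ[K] R''} (hσ : ∀ s x, σ (g s * x) = h s * σ x)
    (hinj : Function.Injective σ) {φ : R →ₗ[K] R'} (hφ : IsDiffOp f h (σ ∘ₗ φ)) :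
    IsDiffOp f g φ := by
  obtain ⟨m, hm⟩ := hφ
  refine ⟨m, ?_⟩
  induction m generalizing φ with
  | zero =>
    rw [mem_diffBetween_zero] at *
    ext x
    exact hinj (by simpa using LinearMap.congr_fun hm x)
  | succ m ih =>
    rw [mem_diffBetween_succ] at *
    exact fun s => ih (commutator_comp_left hσ s φ ▸ hm s)

theorem IsDiffOp.of_comp_right {π : R →ₗ[K] R'} (hπ : ∀ s x, π (f s * x) = g s * π x)
    (hsurj : Function.Surjective π) {φ : R' →ₗ[K] R''} (hφ : IsDiffOp f h (φ ∘ₗ π)) :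
    IsDiffOp g h φ := by
  obtain ⟨m, hm⟩ := hφ
  refine ⟨m, ?_⟩
  induction m generalizing φ with
  | zero =>
    rw [mem_diffBetween_zero] at *
    ext x
    obtain ⟨x, rfl⟩ := hsurj x
    exact LinearMap.congr_fun hm x
  | succ m ih =>
    rw [mem_diffBetween_succ] at *
    exact fun s => ih (commutator_comp_right hπ s φ ▸ hm s)

/-- Differential operators are local: if `φ` vanishes on the multiples `s ^ (k + 1) x`, then `φ x` is
killed by a power of `s`, as one sees by expanding the iterated commutators of `φ` with `s`. -/
theorem IsDiffOp.exists_pow_mul_eq_zero {φ : R →ₗ[K] R'} (hφ : IsDiffOp f g φ) {s : S} {x : R}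
    (hs : ∀ k, φ (f s ^ (k + 1) * x) = 0) : ∃ m, g s ^ m * φ x = 0 := by
  obtain ⟨m, hm⟩ := hφ
  refine ⟨m, ?_⟩
  induction m generalizing φ with
  | zero => rw [mem_diffBetween_zero] at hm; simp [hm]
  | succ m ih =>
    rw [mem_diffBetween_succ] at hm
    have h1 := ih (φ := commutator f g s φ) (fun k => by
      rw [commutator_apply, ← mul_assoc, ← pow_succ', hs, hs, mul_zero, sub_zero]) (hm s)
    rw [commutator_apply, show f s * x = f s ^ (0 + 1) * x by simp, hs, zero_sub, mul_neg,
      neg_eq_zero, ← mul_assoc, ← pow_succ] at h1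
    exact h1

/-- In a domain the power in `IsDiffOp.exists_pow_mul_eq_zero` can be cancelled. -/
theorem IsDiffOp.eq_zero_of_forall_pow_mul [IsDomain R'] {φ : R →ₗ[K] R'} (hφ : IsDiffOp f g φ)
    {s : S} (hg : g s ≠ 0) {x : R} (hs : ∀ k, φ (f s ^ (k + 1) * x) = 0) : φ x = 0 := by
  obtain ⟨m, hm⟩ := hφ.exists_pow_mul_eq_zero hs
  exact (mul_eq_zero.1 hm).resolve_left (pow_ne_zero m hg)

theorem mem_ofOrder_iff_mem_diffBetween (hf : Function.Surjective f) (m : ℕ) :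
    ∀ θ : Module.End K R, θ ∈ ofOrder K R m ↔ θ ∈ diffBetween f f (m + 1) := by
  induction m with
  | zero =>
    intro θ
    rw [mem_ofOrder_zero, mem_diffBetween_succ, hf.forall]
    rfl
  | succ m ih =>
    intro θ
    rw [mem_ofOrder_succ, mem_diffBetween_succ, hf.forall]
    exact forall_congr' fun s => ih _

theorem mem_ring_iff_isDiffOp (hf : Function.Surjective f) (θ : Module.End K R) :
    θ ∈ ring K R ↔ IsDiffOp f f θ := by
  constructor
  · rintro ⟨m, hm⟩
    exact ⟨m + 1, (mem_ofOrder_iff_mem_diffBetween hf m θ).1 hm⟩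
  · rintro ⟨m, hm⟩
    exact ⟨m, (mem_ofOrder_iff_mem_diffBetween hf m θ).2 (diffBetween_monotone m.le_succ hm)⟩

theorem exists_comp_eq_of_forall_mem_range {K M N P : Type*} [Ring K] [AddCommGroup M]
    [AddCommGroup N] [AddCommGroup P] [Module K M] [Module K N] [Module K P] {σ : N →ₗ[K] P}
    (hσ : Function.Injective σ) {ψ : M →ₗ[K] P} (h : ∀ x, ψ x ∈ LinearMap.range σ) :
    ∃ φ : M →ₗ[K] N, ∀ x, σ (φ x) = ψ x := by
  refine ⟨(LinearEquiv.ofInjective σ hσ).symm.toLinearMap ∘ₗ ψ.codRestrict _ h, fun x => ?_⟩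
  have := LinearEquiv.apply_symm_apply (LinearEquiv.ofInjective σ hσ) ⟨ψ x, h x⟩
  exact congrArg Subtype.val this

end Between

/-! ### Lifting differential operators from polynomial rings -/

section Lift

variable {K S R : Type*} [Field K] [CommRing S] [CommRing R] [Algebra K S]
  [Algebra K R]

theorem derivation_mem_ring (D : Derivation K S S) : (D : Module.End K S) ∈ ring K S := by
  refine ⟨1, mem_ofOrder_succ.2 fun a => ?_⟩
  convert mulLeft_mem_ofOrder_zero (K := K) (D a) using 1
  ext b
  simp [mul_comm]

/-- The operators `g δ ^ k` with `g ∈ G`, linearly spanned. -/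
def powSpan (G : Submodule K (Module.End K S)) (δ : Module.End K S) :
    Submodule K (Module.End K S) :=
  Submodule.span K {θ | ∃ g ∈ G, ∃ k, θ = g * δ ^ k}

variable {G : Submodule K (Module.End K S)} {δ : Module.End K S} {x : S}

theorem pow_succ_mul_mulLeft (hδ : δ * LinearMap.mulLeft K x = LinearMap.mulLeft K x * δ + 1)
    (k : ℕ) : δ ^ (k + 1) * LinearMap.mulLeft K x =
      LinearMap.mulLeft K x * δ ^ (k + 1) + (k + 1 : K) • δ ^ k := by
  induction k with
  | zero => simp [hδ]
  | succ k ih =>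
    rw [pow_succ', mul_assoc, ih, mul_add, ← mul_assoc, hδ, add_mul, one_mul, mul_smul_comm,
      ← pow_succ' δ k, mul_assoc]
    push_cast
    rw [add_smul (k + 1 : K) 1, one_smul, add_assoc, add_comm (δ ^ (k + 1))]

/-- The commutator with `x` is surjective on the span of the operators `g δ ^ k`, as
`g δ ^ (k + 1) / (k + 1)` is sent to `g δ ^ k`. -/
theorem exists_commutator_eq [CharZero K]
    (hδ : δ * LinearMap.mulLeft K x = LinearMap.mulLeft K x * δ + 1)
    (hG : ∀ g ∈ G, g * LinearMap.mulLeft K x = LinearMap.mulLeft K x * g)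
    {θ : Module.End K S} (hθ : θ ∈ powSpan G δ) :
    ∃ η ∈ powSpan G δ, η * LinearMap.mulLeft K x - LinearMap.mulLeft K x * η = θ := by
  induction hθ using Submodule.span_induction with
  | mem θ hθ =>
    obtain ⟨g, hg, k, rfl⟩ := hθ
    refine ⟨(k + 1 : K)⁻¹ • (g * δ ^ (k + 1)),
      Submodule.smul_mem _ _ (Submodule.subset_span ⟨g, hg, k + 1, rfl⟩), ?_⟩
    rw [smul_mul_assoc, mul_smul_comm, mul_assoc, pow_succ_mul_mulLeft hδ, mul_add,
      ← mul_assoc, ← mul_assoc, hG g hg, smul_add, add_sub_cancel_left, mul_smul_comm,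
      inv_smul_smul₀ (Nat.cast_add_one_ne_zero k)]
  | zero => exact ⟨0, Submodule.zero_mem _, by simp⟩
  | add a b _ _ ha hb =>
    obtain ⟨η, hη, rfl⟩ := ha
    obtain ⟨ζ, hζ, rfl⟩ := hb
    exact ⟨η + ζ, Submodule.add_mem _ hη hζ, by rw [add_mul, mul_add]; abel⟩
  | smul c a _ ha =>
    obtain ⟨η, hη, rfl⟩ := ha
    exact ⟨c • η, Submodule.smul_mem _ c hη, by rw [smul_mul_assoc, mul_smul_comm, smul_sub]⟩

theorem powSpan_le_ring (hG : G ≤ Subalgebra.toSubmodule (ring K S)) (hδ : δ ∈ ring K S) :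
    powSpan G δ ≤ Subalgebra.toSubmodule (ring K S) :=
  Submodule.span_le.2 fun _ ⟨_, hg, k, e⟩ => e ▸ (ring K S).mul_mem (hG hg) (pow_mem hδ k)

theorem le_powSpan : G ≤ powSpan G δ := fun g hg =>
  Submodule.subset_span ⟨g, hg, 0, by simp⟩

theorem powSpan_commute {z : Module.End K S} (hG : ∀ g ∈ G, g * z = z * g) (hδ : δ * z = z * δ)
    {θ : Module.End K S} (hθ : θ ∈ powSpan G δ) : θ * z = z * θ := by
  induction hθ using Submodule.span_induction with
  | mem θ hθ =>
    obtain ⟨g, hg, k, rfl⟩ := hθ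
    exact (Commute.mul_left (hG g hg) (Commute.pow_left hδ k) : Commute (g * δ ^ k) z)
  | zero => simp
  | add a b _ _ ha hb => rw [add_mul, mul_add, ha, hb]
  | smul c a _ ha => rw [smul_mul_assoc, mul_smul_comm, ha]

theorem isDiffOp_comp_of_mem_ring {θ : Module.End K S} (π : S →ₐ[K] R) (hθ : θ ∈ ring K S) :
    IsDiffOp (AlgHom.id K S) π (π.toLinearMap ∘ₗ θ) :=
  ((mem_ring_iff_isDiffOp (f := AlgHom.id K S) Function.surjective_id θ).1 hθ).comp_left
    (by simp)

theorem commutator_comp_eq (π : S →ₐ[K] R) (θ : Module.End K S) (s : S) :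
    commutator (AlgHom.id K S) π s (π.toLinearMap ∘ₗ θ) =
      π.toLinearMap ∘ₗ (θ * LinearMap.mulLeft K s - LinearMap.mulLeft K s * θ) := by
  ext a
  simp [commutator_apply]

/-- One step of lifting differential operators `S → R` through `π : S → R`: if those operators in a
class `P` that commute with `x` lift to `G`, then all operators in `P` lift to the span of the
operators `g δ ^ k`, where `δ` is a derivation in the direction of `x`. -/
theorem exists_lift_mem_powSpan [CharZero K] (π : S →ₐ[K] R)
    (hδ : δ * LinearMap.mulLeft K x = LinearMap.mulLeft K x * δ + 1)
    (hG : ∀ g ∈ G, g * LinearMap.mulLeft K x = LinearMap.mulLeft K x * g)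
    (hGr : G ≤ Subalgebra.toSubmodule (ring K S)) (hδr : δ ∈ ring K S)
    (P : Submodule K (S →ₗ[K] R)) (hP : ∀ φ ∈ P, commutator (AlgHom.id K S) π x φ ∈ P)
    (hGP : ∀ θ ∈ powSpan G δ, π.toLinearMap ∘ₗ θ ∈ P)
    (hlift : ∀ φ ∈ P, IsDiffOp (AlgHom.id K S) π φ → commutator (AlgHom.id K S) π x φ = 0 →
      ∃ g ∈ G, π.toLinearMap ∘ₗ g = φ)
    {φ : S →ₗ[K] R} (hφP : φ ∈ P) (hφ : IsDiffOp (AlgHom.id K S) π φ) :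
    ∃ θ ∈ powSpan G δ, π.toLinearMap ∘ₗ θ = φ := by
  obtain ⟨m, hm⟩ := hφ
  induction m generalizing φ with
  | zero =>
    rw [mem_diffBetween_zero] at hm
    exact ⟨0, Submodule.zero_mem _, by rw [hm, LinearMap.comp_zero]⟩
  | succ m ih =>
    obtain ⟨θ, hθ, e⟩ := ih (hP φ hφP) (mem_diffBetween_succ.1 hm x)
    obtain ⟨η, hη, rfl⟩ := exists_commutator_eq hδ hG hθ
    obtain ⟨g, hg, e'⟩ := hlift (φ - π.toLinearMap ∘ₗ η) (P.sub_mem hφP (hGP η hη))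
      (IsDiffOp.sub ⟨_, hm⟩ (isDiffOp_comp_of_mem_ring π (powSpan_le_ring hGr hδr hη)))
      (by rw [map_sub, commutator_comp_eq, e, sub_self])
    exact ⟨g + η, Submodule.add_mem _ (le_powSpan hg) hη, by
      rw [LinearMap.comp_add, e', sub_add_cancel]⟩

/-- The multiplications by elements of `S`, as operators. -/
abbrev multiplications (K S : Type*) [Field K] [CommRing S] [Algebra K S] :
    Submodule K (Module.End K S) :=
  LinearMap.range (LinearMap.mul K S)

theorem multiplications_commute (x : S) : ∀ g ∈ multiplications K S,
    g * LinearMap.mulLeft K x = LinearMap.mulLeft K x * g := by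
  rintro _ ⟨a, rfl⟩
  ext b
  simp [mul_left_comm]

theorem multiplications_le_ring :
    multiplications K S ≤ Subalgebra.toSubmodule (ring K S) := by
  rintro _ ⟨a, rfl⟩
  exact mulLeft_mem_ring a

/-- An operator that commutes with algebra generators of `S` is multiplication by its value at `1`,
and so lifts to a multiplication. -/
theorem exists_multiplication_lift (π : S →ₐ[K] R) (hπ : Function.Surjective π) {s : Set S}
    (hs : Algebra.adjoin K s = ⊤) {φ : S →ₗ[K] R}
    (hφ : ∀ a ∈ s, commutator (AlgHom.id K S) π a φ = 0) :
    ∃ g ∈ multiplications K S, π.toLinearMap ∘ₗ g = φ := by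
  have hmul : ∀ a b, φ (a * b) = π a * φ b := by
    intro a
    have ha : a ∈ Algebra.adjoin K s := hs ▸ Algebra.mem_top
    induction ha using Algebra.adjoin_induction with
    | mem a ha => exact fun b => sub_eq_zero.1 (LinearMap.congr_fun (hφ a ha) b)
    | algebraMap c => intro b; simp [← Algebra.smul_def]
    | add a a' _ _ ha ha' => intro b; rw [add_mul, map_add, map_add, add_mul, ha, ha']
    | mul a a' _ _ ha ha' => intro b; rw [mul_assoc, ha, ha', map_mul, mul_assoc]
  obtain ⟨c, hc⟩ := hπ (φ 1)
  refine ⟨LinearMap.mul K S c, ⟨c, rfl⟩, LinearMap.ext fun a => ?_⟩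
  have := hmul a 1
  rw [mul_one, ← hc] at this
  simp [this, mul_comm]

theorem derivation_mul_mulLeft (D : Derivation K S S) (x : S) :
    (D : Module.End K S) * LinearMap.mulLeft K x =
      LinearMap.mulLeft K x * (D : Module.End K S) + LinearMap.mulLeft K (D x) := by
  ext b
  simp [mul_comm]

/-- The differential operators of `K[X]` are the polynomials in `d / dX` with coefficients in
`K[X]`. -/
theorem ring_polynomial_le_adjoin [CharZero K] : ring K (Polynomial K) ≤
    Algebra.adjoin K {LinearMap.mulLeft K Polynomial.X, Polynomial.derivative} := by
  intro θ hθ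
  obtain ⟨η, hη, e⟩ := exists_lift_mem_powSpan (AlgHom.id K (Polynomial K))
    (δ := Polynomial.derivative) (x := Polynomial.X) (G := multiplications K (Polynomial K))
    (by
      refine (derivation_mul_mulLeft Polynomial.derivative' Polynomial.X).trans ?_
      rw [Polynomial.derivative'_apply, Polynomial.derivative_X, LinearMap.mulLeft_one]
      rfl)
    (multiplications_commute _) multiplications_le_ring
    (derivation_mem_ring Polynomial.derivative') ⊤ (by simp) (by simp)
    (fun φ _ _ h => exists_multiplication_lift _ Function.surjective_id Polynomial.adjoin_X
      (by simpa using h))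
    Submodule.mem_top
    ((mem_ring_iff_isDiffOp (f := AlgHom.id K _) Function.surjective_id θ).1 hθ)
  obtain rfl : η = θ := by simpa using e
  refine (Submodule.span_le (p := Subalgebra.toSubmodule (Algebra.adjoin K _))).2 ?_ hη
  rintro _ ⟨_, ⟨p, rfl⟩, k, rfl⟩
  refine Subalgebra.mul_mem _ ?_ (pow_mem (Algebra.subset_adjoin (by simp)) k)
  have hp : Polynomial.aeval (Algebra.lmul K (Polynomial K) Polynomial.X) p =
      Algebra.lmul K (Polynomial K) p := by
    rw [Polynomial.aeval_algHom_apply, Polynomial.aeval_X_left_apply]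
  exact hp ▸ Algebra.adjoin_mono (by rw [Set.singleton_subset_iff]; exact Or.inl rfl)
    (Polynomial.aeval_mem_adjoin_singleton K _)

/-- Every differential operator on a quotient of `K[x, y]`, composed with the quotient map, lifts to a
differential operator on `K[x, y]`. -/
theorem exists_ring_lift [CharZero K] (π : MvPolynomial (Fin 2) K →ₐ[K] R)
    (hπ : Function.Surjective π) {φ : MvPolynomial (Fin 2) K →ₗ[K] R}
    (hφ : IsDiffOp (AlgHom.id K _) π φ) :
    ∃ θ ∈ ring K (MvPolynomial (Fin 2) K), π.toLinearMap ∘ₗ θ = φ := by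
  let D : Fin 2 → Derivation K (MvPolynomial (Fin 2) K) (MvPolynomial (Fin 2) K) :=
    MvPolynomial.pderiv
  have hD : ∀ i, (D i : Module.End K (MvPolynomial (Fin 2) K)) *
      LinearMap.mulLeft K (MvPolynomial.X i) =
        LinearMap.mulLeft K (MvPolynomial.X i) * (D i : Module.End K _) + 1 := fun i => by
    rw [derivation_mul_mulLeft, MvPolynomial.pderiv_X_self, LinearMap.mulLeft_one]
    rfl
  have hcomm : ∀ θ ∈ powSpan (multiplications K _)
      (D 1 : Module.End K (MvPolynomial (Fin 2) K)),
      θ * LinearMap.mulLeft K (MvPolynomial.X 0) =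
        LinearMap.mulLeft K (MvPolynomial.X 0) * θ := by
    intro θ hθ
    refine powSpan_commute (multiplications_commute _) ?_ hθ
    rw [derivation_mul_mulLeft, MvPolynomial.pderiv_X_of_ne (by decide),
      LinearMap.mulLeft_zero_eq_zero, add_zero]
  have hr := powSpan_le_ring (multiplications_le_ring (K := K)) (derivation_mem_ring (D 1))
  obtain ⟨θ, hθ, e⟩ := exists_lift_mem_powSpan π (hD 0) hcomm hr (derivation_mem_ring _) ⊤
    (by simp) (by simp) (fun ψ _ hψ h0 => exists_lift_mem_powSpan π (hD 1)
      (multiplications_commute _) multiplications_le_ring (derivation_mem_ring _)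
      (LinearMap.ker (commutator (AlgHom.id K _) π (MvPolynomial.X 0)))
      (fun χ hχ => by
        have h (a) : χ (MvPolynomial.X 0 * a) = π (MvPolynomial.X 0) * χ a :=
          sub_eq_zero.1 (LinearMap.congr_fun (LinearMap.mem_ker.1 hχ) a)
        refine LinearMap.mem_ker.2 (LinearMap.ext fun a => ?_)
        simp only [commutator_apply, AlgHom.coe_id, id_eq, LinearMap.zero_apply]
        rw [mul_left_comm, h, h]
        ring)
      (fun χ hχ => by
        rw [LinearMap.mem_ker, commutator_comp_eq, hcomm χ hχ, sub_self, LinearMap.comp_zero])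
      (fun χ hχ _ h1 => exists_multiplication_lift π hπ MvPolynomial.adjoin_range_X (by
        rintro _ ⟨i, rfl⟩
        fin_cases i
        · exact hχ
        · exact h1))
      h0 hψ) Submodule.mem_top hφ
  exact ⟨θ, powSpan_le_ring hr (derivation_mem_ring _) hθ, e⟩

end Lift

/-! ### Products of Weyl algebras -/

section WeylProduct

theorem fg_ker_act_of_tower {K C W : Type*} [Field K] [CharZero K] [CommRing C] [Ring W]
    [Algebra K C] [Module.Finite K C] [Algebra C W] [Algebra K W] [IsScalarTower K C W] {x d : W}
    (h : d * x = x * d + 1) (hgen : Algebra.adjoin C {x, d} = ⊤) {u : C} (hu : IsUnit u) (n : ℕ)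
    (Z : Ideal W) :
    (LinearMap.ker (act K (W ⧸ Z) (algebraMap C W u * x ^ n))).FG := by
  have : IsNoetherianRing C := isNoetherian_of_tower K inferInstance
  have : IsNoetherianRing W := isNoetherianRing_of_weyl h hgen
  have : IsAddTorsionFree (W ⧸ Z) := IsAddTorsionFree.of_isTorsionFree K _
  have h1 := Submodule.FG.restrictScalars (R := K) (fg_ker_act_pow (M := W ⧸ Z) h hgen n)
  have e : LinearMap.ker (act K (W ⧸ Z) (algebraMap C W u * x ^ n)) =
      (LinearMap.ker (act C (W ⧸ Z) (x ^ n))).restrictScalars K := by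
    refine Submodule.ext fun (m : W ⧸ Z) => ?_
    change (algebraMap C W u * x ^ n) • m = 0 ↔ x ^ n • m = 0
    rw [mul_smul, algebraMap_smul]
    exact hu.smul_eq_zero
  rw [e]
  exact h1

variable {K ι : Type*} [Field K]

variable (K) in
/-- Multiplication by `X`, as a differential operator of `K[X]`. -/
noncomputable def xOp : ring K (Polynomial K) := ⟨_, mulLeft_mem_ring Polynomial.X⟩

variable (K) in
/-- The derivative, as a differential operator of `K[X]`. -/
noncomputable def dOp : ring K (Polynomial K) := ⟨_, derivation_mem_ring Polynomial.derivative'⟩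

theorem dOp_mul_xOp : dOp K * xOp K = xOp K * dOp K + 1 := by
  refine Subtype.ext ?_
  refine (derivation_mul_mulLeft Polynomial.derivative' Polynomial.X).trans ?_
  rw [Polynomial.derivative'_apply, Polynomial.derivative_X, LinearMap.mulLeft_one]
  rfl

variable (K ι) in
/-- A product of copies of the ring of differential operators of `K[X]`. -/
def WeylProduct := ι → ring K (Polynomial K)

noncomputable instance : Ring (WeylProduct K ι) :=
  inferInstanceAs (Ring (ι → ring K (Polynomial K)))

noncomputable instance : Algebra K (WeylProduct K ι) :=
  inferInstanceAs (Algebra K (ι → ring K (Polynomial K)))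

noncomputable instance : Algebra (ι → K) (WeylProduct K ι) :=
  inferInstanceAs (Algebra (ι → K) (ι → ring K (Polynomial K)))

instance : IsScalarTower K (ι → K) (WeylProduct K ι) :=
  ⟨fun a c w => funext fun i => smul_assoc a (c i) (w i)⟩

variable (K ι) in
/-- The element of the product with all components `X`. -/
noncomputable def xProd : WeylProduct K ι := fun _ => xOp K

variable (K ι) in
/-- The element of the product with all components the derivative. -/
noncomputable def dProd : WeylProduct K ι := fun _ => dOp K

theorem dProd_mul_xProd : dProd K ι * xProd K ι = xProd K ι * dProd K ι + 1 :=
  funext fun _ => dOp_mul_xOp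

theorem adjoin_weylProduct [CharZero K] [Finite ι] :
    Algebra.adjoin (ι → K) {xProd K ι, dProd K ι} = ⊤ := by
  classical
  have := Fintype.ofFinite ι
  set S := Algebra.adjoin (ι → K) {xProd K ι, dProd K ι} with hS
  -- `E i w` is the element with `i`-th component `w` and zeros elsewhere
  let E (i : ι) (w : ring K (Polynomial K)) : WeylProduct K ι := Pi.single i w
  have hE : ∀ i, ∀ c : K, ∀ v ∈ S, E i (c • v i) ∈ S := by
    intro i c v hv
    have : E i (c • v i) = algebraMap (ι → K) (WeylProduct K ι) (Pi.single i c) * v := by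
      rw [← Algebra.smul_def]
      funext j
      change (Pi.single i (c • v i) : ι → ring K (Polynomial K)) j = (Pi.single i c : ι → K) j • v j
      rcases eq_or_ne j i with rfl | hj
      · simp
      · simp [hj]
    rw [this]
    exact S.mul_mem (S.algebraMap_mem _) hv
  have key : ∀ i, ∀ θ ∈ Algebra.adjoin K {LinearMap.mulLeft K (Polynomial.X : Polynomial K),
      Polynomial.derivative}, ∃ hθ : θ ∈ ring K (Polynomial K), E i ⟨θ, hθ⟩ ∈ S := by
    intro i θ hθ
    induction hθ using Algebra.adjoin_induction with
    | mem θ hθ =>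
      rcases hθ with rfl | rfl
      · have := hE i 1 _ (Algebra.subset_adjoin (Set.mem_insert _ _))
        rw [one_smul] at this
        exact ⟨(xOp K).2, this⟩
      · have := hE i 1 _ (Algebra.subset_adjoin (Set.mem_insert_of_mem _ rfl))
        rw [one_smul] at this
        exact ⟨(dOp K).2, this⟩
    | algebraMap c =>
      refine ⟨Subalgebra.algebraMap_mem _ c, ?_⟩
      have h := hE i c 1 S.one_mem
      have e : c • (1 : WeylProduct K ι) i = algebraMap K (ring K (Polynomial K)) c :=
        (Algebra.algebraMap_eq_smul_one c).symm
      rw [e] at h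
      exact h
    | add a b _ _ ha hb =>
      obtain ⟨ha, ha'⟩ := ha
      obtain ⟨hb, hb'⟩ := hb
      refine ⟨add_mem ha hb, ?_⟩
      have e : E i ⟨a, ha⟩ + E i ⟨b, hb⟩ = E i (⟨a, ha⟩ + ⟨b, hb⟩) := (Pi.single_add i _ _).symm
      exact e ▸ S.add_mem ha' hb'
    | mul a b _ _ ha hb =>
      obtain ⟨ha, ha'⟩ := ha
      obtain ⟨hb, hb'⟩ := hb
      refine ⟨mul_mem ha hb, ?_⟩
      have e : E i ⟨a, ha⟩ * E i ⟨b, hb⟩ = E i (⟨a, ha⟩ * ⟨b, hb⟩) := (Pi.single_mul i _ _).symm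
      exact e ▸ S.mul_mem ha' hb'
  refine Algebra.eq_top_iff.2 fun w => ?_
  have hw : ∑ i, E i (w i) = w := Finset.univ_sum_single (f := w)
  rw [← hw]
  exact S.sum_mem fun i _ => (key i _ (ring_polynomial_le_adjoin (w i).2)).2

theorem adjoin_op_weylProduct [CharZero K] [Finite ι] :
    Algebra.adjoin (ι → K) {MulOpposite.op (xProd K ι),
      -MulOpposite.op (dProd K ι)} = ⊤ := by
  have h := congrArg Subalgebra.op (adjoin_weylProduct (K := K) (ι := ι))
  rw [Subalgebra.op_adjoin, Subalgebra.op_top] at h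
  refine top_le_iff.1 (h.symm.le.trans (Algebra.adjoin_le fun w hw => ?_))
  rcases hw with hw | hw
  · exact Algebra.subset_adjoin (Or.inl (MulOpposite.unop_injective hw))
  · rw [← neg_neg w]
    refine Subalgebra.neg_mem _ (Algebra.subset_adjoin (Or.inr ?_))
    exact congrArg Neg.neg (MulOpposite.unop_injective hw)

theorem op_const_relation :
    -MulOpposite.op (dProd K ι) * MulOpposite.op (xProd K ι) =
      MulOpposite.op (xProd K ι) * -MulOpposite.op (dProd K ι) + 1 := by
  rw [neg_mul, mul_neg, ← MulOpposite.op_mul, ← MulOpposite.op_mul, dProd_mul_xProd,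
    MulOpposite.op_add, MulOpposite.op_one]
  abel

instance weylProduct_isNoetherianRing [CharZero K] [Finite ι] :
    IsNoetherianRing (WeylProduct K ι) :=
  have : IsNoetherianRing (ι → K) := isNoetherian_of_tower K inferInstance
  isNoetherianRing_of_weyl dProd_mul_xProd adjoin_weylProduct

instance op_weylProduct_isNoetherianRing [CharZero K] [Finite ι] :
    IsNoetherianRing (WeylProduct K ι)ᵐᵒᵖ :=
  have : IsNoetherianRing (ι → K) := isNoetherian_of_tower K inferInstance
  isNoetherianRing_of_weyl op_const_relation adjoin_op_weylProduct

/-- The multiplication by `u i X ^ n` in the `i`-th factor. -/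
noncomputable def scaledPow (u : ι → K) (n : ℕ) : WeylProduct K ι :=
  fun i => u i • xOp K ^ n

theorem scaledPow_eq (u : ι → K) (n : ℕ) : scaledPow u n =
    algebraMap (ι → K) (WeylProduct K ι) u * xProd K ι ^ n := by
  rw [← Algebra.smul_def]
  funext i
  change u i • xOp K ^ n = u i • (xProd K ι ^ n) i
  rfl

theorem coe_scaledPow_apply (u : ι → K) (n : ℕ) (i : ι) (f : Polynomial K) :
    (scaledPow u n i : Module.End K (Polynomial K)) f =
      Polynomial.C (u i) * Polynomial.X ^ n * f := by
  have h : ((xOp K ^ n : ring K (Polynomial K)) : Module.End K (Polynomial K)) =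
      LinearMap.mulLeft K (Polynomial.X ^ n) :=
    LinearMap.pow_mulLeft K (Polynomial K) Polynomial.X n
  rw [scaledPow, Subalgebra.coe_smul, h, LinearMap.smul_apply, LinearMap.mulLeft_apply,
    Polynomial.smul_eq_C_mul, mul_assoc]

theorem fg_ker_scaledPow [CharZero K] [Finite ι] {u : ι → K} (hu : ∀ i, u i ≠ 0) (n : ℕ)
    (Z : Ideal (WeylProduct K ι)) :
    (LinearMap.ker (act K (WeylProduct K ι ⧸ Z) (scaledPow u n))).FG := by
  rw [scaledPow_eq]
  exact fg_ker_act_of_tower dProd_mul_xProd adjoin_weylProduct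
    (Pi.isUnit_iff.2 fun i => (hu i).isUnit) n Z

theorem fg_ker_op_scaledPow [CharZero K] [Finite ι] {u : ι → K} (hu : ∀ i, u i ≠ 0) (n : ℕ)
    (Z : Ideal (WeylProduct K ι)ᵐᵒᵖ) :
    (LinearMap.ker (act K ((WeylProduct K ι)ᵐᵒᵖ ⧸ Z) (MulOpposite.op (scaledPow u n)))).FG := by
  rw [scaledPow_eq, MulOpposite.op_mul, MulOpposite.op_pow]
  have := fg_ker_act_of_tower (K := K) op_const_relation (adjoin_op_weylProduct (K := K) (ι := ι))
    (Pi.isUnit_iff.2 fun i => (hu i).isUnit : IsUnit u) n Z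
  rwa [Algebra.commutes] at this

end WeylProduct

/-! ### Subrings of a product of polynomial rings -/

section Branches

/-- A quotient `A` of `S` that embeds into a finite product of polynomial rings `K[X]`, one for each
branch `i`, and that contains the ideal `X ^ order K[X]` of each factor. The functions `p i` and `q i`
separate the branches: `p i` vanishes on the branch `i` only, and `q i` on all other branches. -/
structure Branches (K S A ι : Type*) [Field K] [CommRing S] [CommRing A] [Algebra K S]
    [Algebra K A] where
  /-- The quotient map. -/
  proj : S →ₐ[K] A
  proj_surjective : Function.Surjective proj
  /-- The restriction from `S` to a branch. -/
  branch : ι → S →ₐ[K] Polynomial K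
  branch_surjective : ∀ i, Function.Surjective (branch i)
  /-- The restriction from `A` to a branch. -/
  eval : ι → A →ₐ[K] Polynomial K
  eval_proj : ∀ i s, eval i (proj s) = branch i s
  /-- Functions vanishing on one branch. -/
  p : ι → S
  branch_p_self : ∀ i, branch i (p i) = 0
  branch_p_of_ne : ∀ i j, j ≠ i → branch j (p i) ≠ 0
  /-- Functions vanishing on all branches but one. -/
  q : ι → S
  /-- The order of vanishing of `q i` at the origin of the branch `i`. -/
  order : ℕ
  /-- The leading coefficient of `q i` on the branch `i`. -/
  coeff : ι → K
  coeff_ne_zero : ∀ i, coeff i ≠ 0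
  branch_q_self : ∀ i, branch i (q i) = Polynomial.C (coeff i) * Polynomial.X ^ order
  branch_q_of_ne : ∀ i j, j ≠ i → branch j (q i) = 0
  /-- The multiplication by `q i`, which factors through the branch `i`. -/
  incl : ι → Polynomial K →ₗ[K] A
  incl_branch : ∀ i s, incl i (branch i s) = proj (q i * s)
  eq_zero_of_eval : ∀ a, (∀ i, eval i a = 0) → a = 0
  mem_range_incl : ∀ i a, (∀ j, j ≠ i → eval j a = 0) → a ∈ LinearMap.range (incl i)

namespace Branches

variable {K S A ι : Type*} [Field K] [CommRing S] [CommRing A] [Algebra K S] [Algebra K A]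
  (b : Branches K S A ι)

theorem eval_surjective (i : ι) : Function.Surjective (b.eval i) := fun f => by
  obtain ⟨s, rfl⟩ := b.branch_surjective i f
  exact ⟨b.proj s, b.eval_proj i s⟩

theorem eval_mul (i : ι) (s : S) (a : A) :
    (b.eval i).toLinearMap (b.proj s * a) = b.branch i s * (b.eval i).toLinearMap a := by
  simp [b.eval_proj]

theorem incl_mul (i : ι) (s : S) (f : Polynomial K) :
    b.incl i (b.branch i s * f) = b.proj s * b.incl i f := by
  obtain ⟨t, rfl⟩ := b.branch_surjective i f
  rw [← map_mul, b.incl_branch, b.incl_branch, ← map_mul, mul_left_comm]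

theorem incl_eval (i : ι) (a : A) : b.incl i (b.eval i a) = b.proj (b.q i) * a := by
  obtain ⟨s, rfl⟩ := b.proj_surjective a
  rw [b.eval_proj, b.incl_branch, map_mul]

theorem eval_incl_self (i : ι) (f : Polynomial K) :
    b.eval i (b.incl i f) = Polynomial.C (b.coeff i) * Polynomial.X ^ b.order * f := by
  obtain ⟨s, rfl⟩ := b.branch_surjective i f
  rw [b.incl_branch, b.eval_proj, map_mul, b.branch_q_self]

theorem eval_incl_of_ne {i j : ι} (h : j ≠ i) (f : Polynomial K) : b.eval j (b.incl i f) = 0 := by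
  obtain ⟨s, rfl⟩ := b.branch_surjective i f
  rw [b.incl_branch, b.eval_proj, map_mul, b.branch_q_of_ne i j h, zero_mul]

theorem branch_q_ne_zero (i : ι) : b.branch i (b.q i) ≠ 0 := by
  rw [b.branch_q_self]
  exact mul_ne_zero (Polynomial.C_ne_zero.2 (b.coeff_ne_zero i))
    (pow_ne_zero _ Polynomial.X_ne_zero)

theorem mulLeft_branch_q_injective (i : ι) :
    Function.Injective (LinearMap.mulLeft K (b.branch i (b.q i))) := fun _ _ h =>
  mul_left_cancel₀ (b.branch_q_ne_zero i) h

theorem incl_injective (i : ι) : Function.Injective (b.incl i) := fun f g h => by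
  have := congrArg (b.eval i) h
  rw [b.eval_incl_self, b.eval_incl_self, ← b.branch_q_self] at this
  exact mul_left_cancel₀ (b.branch_q_ne_zero i) this

theorem isDiffOp_of_mem_ring {θ : Module.End K A} (hθ : θ ∈ ring K A) :
    IsDiffOp b.proj b.proj θ :=
  (mem_ring_iff_isDiffOp b.proj_surjective θ).1 hθ

/-- A differential operator of `A` preserves the ideal `q i A` of functions vanishing on all branches
but the `i`-th, by locality, and so induces a differential operator of the polynomial ring. -/
theorem exists_component (i : ι) {θ : Module.End K A} (hθ : θ ∈ ring K A) :
    ∃ η ∈ ring K (Polynomial K), ∀ f, b.incl i (η f) = θ (b.incl i f) := by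
  have hd : IsDiffOp (b.branch i) b.proj (θ ∘ₗ b.incl i) :=
    (b.isDiffOp_of_mem_ring hθ).comp_right (b.incl_mul i)
  obtain ⟨η, hη⟩ := exists_comp_eq_of_forall_mem_range (b.incl_injective i)
    (ψ := θ ∘ₗ b.incl i) fun f => b.mem_range_incl i _ fun j hj =>
      IsDiffOp.eq_zero_of_forall_pow_mul (φ := (b.eval j).toLinearMap ∘ₗ θ ∘ₗ b.incl i)
        (hd.comp_left (b.eval_mul j)) (b.branch_p_of_ne i j hj) fun k => by
          rw [b.branch_p_self, zero_pow k.succ_ne_zero, zero_mul, map_zero]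
  refine ⟨η, (mem_ring_iff_isDiffOp (b.branch_surjective i) η).2
    (IsDiffOp.of_comp_left (b.incl_mul i) (b.incl_injective i) ?_), hη⟩
  rwa [show b.incl i ∘ₗ η = θ ∘ₗ b.incl i from LinearMap.ext hη]

/-- The operator induced by `θ` on the polynomial ring of the branch `i`, through `incl i`. -/
noncomputable def component (i : ι) (θ : ring K A) : ring K (Polynomial K) :=
  ⟨_, (b.exists_component i θ.2).choose_spec.1⟩

theorem incl_component (i : ι) (θ : ring K A) (f : Polynomial K) :
    b.incl i ((b.component i θ : Module.End K (Polynomial K)) f) =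
      (θ : Module.End K A) (b.incl i f) :=
  (b.exists_component i θ.2).choose_spec.2 f

theorem component_eq {i : ι} {θ : ring K A} {η : ring K (Polynomial K)}
    (h : ∀ f, b.incl i ((η : Module.End K (Polynomial K)) f) =
      (θ : Module.End K A) (b.incl i f)) : b.component i θ = η :=
  Subtype.ext (LinearMap.ext fun f => b.incl_injective i (by rw [b.incl_component, h]))

/-- The action of the differential operators of `A` on the ideals `q i A`, as a homomorphism to a
product of rings of differential operators of `K[X]`. -/
noncomputable def toProd : ring K A →ₐ[K] WeylProduct K ι where
  toFun θ i := b.component i θ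
  map_one' := funext fun i => b.component_eq fun _ => rfl
  map_zero' := funext fun i => b.component_eq fun _ => map_zero _
  map_mul' θ θ' := funext fun i => b.component_eq fun f => by
    change b.incl i ((b.component i θ : Module.End K (Polynomial K))
      ((b.component i θ' : Module.End K (Polynomial K)) f)) = _
    rw [b.incl_component, b.incl_component]
    rfl
  map_add' θ θ' := funext fun i => b.component_eq fun f => by
    change b.incl i ((b.component i θ : Module.End K (Polynomial K)) f +
      (b.component i θ' : Module.End K (Polynomial K)) f) = _
    rw [map_add, b.incl_component, b.incl_component]
    rfl
  commutes' c := funext fun i => b.component_eq fun f => by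
    change b.incl i (c • f) = c • b.incl i f
    rw [map_smul]

/-- An operator that kills the ideals `q i A` is zero on every branch, by locality. -/
theorem toProd_injective : Function.Injective b.toProd := by
  refine (injective_iff_map_eq_zero _).2 fun θ hθ => Subtype.ext (LinearMap.ext fun a => ?_)
  have hincl : ∀ i f, (θ : Module.End K A) (b.incl i f) = 0 := fun i f => by
    have h0 : b.component i θ = 0 := congrFun hθ i
    rw [← b.incl_component, h0]
    exact map_zero _
  refine b.eq_zero_of_eval _ fun i => ?_
  refine IsDiffOp.eq_zero_of_forall_pow_mul (φ := (b.eval i).toLinearMap ∘ₗ (θ : Module.End K A))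
    ((b.isDiffOp_of_mem_ring θ.2).comp_left (b.eval_mul i)) (b.branch_q_ne_zero i) fun k => ?_
  rw [pow_succ', mul_assoc, ← b.incl_eval, LinearMap.comp_apply, hincl, map_zero]

/-- The element of the product whose `i`-th component is the restriction of `q i` to the branch. -/
noncomputable abbrev conductor : WeylProduct K ι := scaledPow b.coeff b.order

theorem conductor_apply (i : ι) (f : Polynomial K) :
    (b.conductor i : Module.End K (Polynomial K)) f = b.branch i (b.q i) * f := by
  rw [coe_scaledPow_apply, b.branch_q_self]

/-- The element `w * conductor` is the image of the operator `∑ i, incl i ∘ w i ∘ eval i` of `A`. -/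
theorem mul_conductor_mem_range [Finite ι] (w : WeylProduct K ι) :
    w * b.conductor ∈ b.toProd.range := by
  have := Fintype.ofFinite ι
  let τ (i : ι) : Module.End K A :=
    b.incl i ∘ₗ (w i : Module.End K (Polynomial K)) ∘ₗ (b.eval i).toLinearMap
  have hτ : ∀ i, τ i ∈ ring K A := fun i => by
    refine (mem_ring_iff_isDiffOp b.proj_surjective _).2 (IsDiffOp.comp_left (b.incl_mul i)
      (IsDiffOp.comp_right (b.eval_mul i) ?_))
    exact (mem_ring_iff_isDiffOp (b.branch_surjective i) _).1 (w i).2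
  refine ⟨⟨∑ i, τ i, sum_mem fun i _ => hτ i⟩, funext fun i => b.component_eq fun f => ?_⟩
  change b.incl i ((w i : Module.End K (Polynomial K))
    ((b.conductor i : Module.End K (Polynomial K)) f)) = (∑ j, τ j) (b.incl i f)
  rw [b.conductor_apply, LinearMap.sum_apply, Finset.sum_eq_single i]
  · change _ = b.incl i ((w i : Module.End K (Polynomial K)) (b.eval i (b.incl i f)))
    rw [b.eval_incl_self, b.branch_q_self]
  · intro j _ hj
    change b.incl j ((w j : Module.End K (Polynomial K)) (b.eval j (b.incl i f))) = 0
    rw [b.eval_incl_of_ne hj, map_zero, map_zero]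
  · exact fun h => absurd (Finset.mem_univ i) h

/-- An operator with values in the sum of the ideals `q i A` maps into the left ideal generated by
`conductor`. -/
theorem exists_toProd_eq_mul_conductor {θ : ring K A}
    (hθ : ∀ i a, b.branch i (b.q i) ∣ b.eval i ((θ : Module.End K A) a)) :
    ∃ w, b.toProd θ = w * b.conductor := by
  have key : ∀ i, ∃ w : ring K (Polynomial K), b.component i θ = w * b.conductor i := by
    intro i
    let φ : A →ₗ[K] Polynomial K := (b.eval i).toLinearMap ∘ₗ (θ : Module.End K A)
    have hφ : IsDiffOp b.proj (b.branch i) φ :=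
      (b.isDiffOp_of_mem_ring θ.2).comp_left (b.eval_mul i)
    have hker : ∀ a, b.eval i a = 0 → φ a = 0 := fun a ha =>
      hφ.eq_zero_of_forall_pow_mul (b.branch_q_ne_zero i) fun k => by
        rw [pow_succ, mul_assoc, ← b.incl_eval, ha, map_zero, mul_zero, map_zero]
    obtain ⟨χ, hχ⟩ := exists_comp_eq_of_forall_mem_range (b.mulLeft_branch_q_injective i)
      (ψ := φ) fun a => (hθ i a).imp fun _ h => h.symm
    obtain ⟨r, hr⟩ := (b.eval i).toLinearMap.exists_rightInverse_of_surjective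
      (LinearMap.range_eq_top.2 (b.eval_surjective i))
    have hw : ∀ a, b.branch i (b.q i) * χ (r (b.eval i a)) = φ a := fun a => by
      have h1 : φ (r (b.eval i a) - a) = 0 := hker _ (by
        rw [map_sub, sub_eq_zero]
        exact LinearMap.congr_fun hr (b.eval i a))
      rw [map_sub, sub_eq_zero] at h1
      rw [← h1]
      exact hχ _
    have hmem : χ ∘ₗ r ∈ ring K (Polynomial K) := by
      refine (mem_ring_iff_isDiffOp (b.branch_surjective i) _).2
        (IsDiffOp.of_comp_left (σ := LinearMap.mulLeft K (b.branch i (b.q i)))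
          (fun s f => mul_left_comm _ _ _) (b.mulLeft_branch_q_injective i)
          (IsDiffOp.of_comp_right (b.eval_mul i) (b.eval_surjective i) ?_))
      convert hφ using 1
      exact LinearMap.ext hw
    refine ⟨⟨_, hmem⟩, Subtype.ext (LinearMap.ext fun f =>
      mul_left_cancel₀ (b.branch_q_ne_zero i) ?_)⟩
    have e₁ : b.branch i (b.q i) * (b.component i θ : Module.End K (Polynomial K)) f =
        φ (b.incl i f) := by
      rw [b.branch_q_self, ← b.eval_incl_self, b.incl_component]
      rfl
    have e₂ : b.branch i (b.q i) * f = b.eval i (b.incl i f) := by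
      rw [b.eval_incl_self, b.branch_q_self]
    change _ = b.branch i (b.q i) * χ (r ((b.conductor i : Module.End K (Polynomial K)) f))
    rw [b.conductor_apply, e₂, hw]
    exact e₁
  choose w hw using key
  exact ⟨w, funext hw⟩

/-- The truncated Taylor expansions of an element of `A` along the branches. -/
noncomputable def truncation : A →ₗ[K] (ι → Fin b.order → K) :=
  LinearMap.pi fun i => LinearMap.pi fun k => Polynomial.lcoeff K k ∘ₗ (b.eval i).toLinearMap

theorem truncation_eq_zero_iff (a : A) :
    b.truncation a = 0 ↔ ∀ i, b.branch i (b.q i) ∣ b.eval i a := by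
  have hu : ∀ i, IsUnit (Polynomial.C (b.coeff i)) := fun i =>
    Polynomial.isUnit_C.2 (b.coeff_ne_zero i).isUnit
  simp only [b.branch_q_self, (hu _).mul_left_dvd, Polynomial.X_pow_dvd_iff, funext_iff]
  exact forall_congr' fun i => ⟨fun h k hk => h ⟨k, hk⟩, fun h k => h k k.2⟩

theorem truncation_eq_zero_iff_exists [Fintype ι] (a : A) :
    b.truncation a = 0 ↔ ∃ f : ι → Polynomial K, a = ∑ i, b.incl i (f i) := by
  have hsum : ∀ (f : ι → Polynomial K) i, b.eval i (∑ j, b.incl j (f j)) =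
      b.branch i (b.q i) * f i := fun f i => by
    rw [map_sum, Finset.sum_eq_single i, b.eval_incl_self, b.branch_q_self]
    · exact fun j _ hj => b.eval_incl_of_ne hj.symm _
    · exact fun h => absurd (Finset.mem_univ i) h
  rw [truncation_eq_zero_iff]
  constructor
  · intro h
    choose f hf using h
    refine ⟨f, sub_eq_zero.1 (b.eq_zero_of_eval _ fun i => ?_)⟩
    rw [map_sub, hsum, hf, sub_self]
  · rintro ⟨f, rfl⟩ i
    exact ⟨f i, hsum f i⟩

/-- The operators with values in the sum of the ideals `q i A` have finite codimension. -/
theorem exists_finite_obstruction [Finite ι] : ∃ (s : Finset A)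
    (ψ : ring K A →ₗ[K] (s → ι → Fin b.order → K)),
    ∀ θ, ψ θ = 0 → ∃ w, b.toProd θ = w * b.conductor := by
  have := Fintype.ofFinite ι
  obtain ⟨s, -, hs⟩ := exists_finset_le_span_sup_ker b.truncation (A := ⊤)
    (IsNoetherian.noetherian _)
  refine ⟨s, LinearMap.pi fun a => b.truncation ∘ₗ LinearMap.applyₗ (a : A) ∘ₗ
    (ring K A).val.toLinearMap, fun θ hθ => b.exists_toProd_eq_mul_conductor fun i a => ?_⟩
  refine (b.truncation_eq_zero_iff _).1 ?_ i
  obtain ⟨a₁, ha₁, a₂, ha₂, rfl⟩ := Submodule.mem_sup.1 (hs (Submodule.mem_top (x := a)))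
  have h1 : Submodule.span K (s : Set A) ≤
      LinearMap.ker (b.truncation ∘ₗ (θ : Module.End K A)) :=
    Submodule.span_le.2 fun c hc => congrFun hθ ⟨c, hc⟩
  obtain ⟨f, rfl⟩ := (b.truncation_eq_zero_iff_exists a₂).1 ha₂
  rw [map_add, map_add, show b.truncation ((θ : Module.End K A) a₁) = 0 from h1 ha₁, zero_add,
    truncation_eq_zero_iff_exists]
  exact ⟨fun i => (b.component i θ : Module.End K (Polynomial K)) (f i), by
    simp only [map_sum, b.incl_component]⟩

theorem isNoetherianRing_ring [CharZero K] [Finite ι] (b : Branches K S A ι) :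
    IsNoetherianRing (ring K A) :=
  isNoetherianRing_of_mul_right_mem_range (T := ring K A) (W := WeylProduct K ι) b.toProd
    b.toProd_injective b.conductor b.mul_conductor_mem_range
    (fg_ker_scaledPow b.coeff_ne_zero b.order)

theorem isNoetherianRing_op_ring [CharZero K] [Finite ι] (b : Branches K S A ι) :
    IsNoetherianRing (ring K A)ᵐᵒᵖ := by
  obtain ⟨s, ψ, hψ⟩ := b.exists_finite_obstruction
  refine isNoetherianRing_of_mul_left_mem_range (AlgHom.op b.toProd)
    (fun x y h => MulOpposite.unop_injective (b.toProd_injective (MulOpposite.op_injective h)))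
    (MulOpposite.op b.conductor) (fun w => ?_) (fg_ker_op_scaledPow b.coeff_ne_zero b.order)
    (ψ ∘ₗ (MulOpposite.opLinearEquiv K).symm.toLinearMap) (fun t ht => ?_)
  · obtain ⟨θ, hθ⟩ := b.mul_conductor_mem_range w.unop
    exact ⟨MulOpposite.op θ, congrArg MulOpposite.op hθ⟩
  · obtain ⟨w, hw⟩ := hψ t.unop ht
    exact ⟨MulOpposite.op w, congrArg MulOpposite.op hw⟩

end Branches

end Branches

/-! ### Central arrangements of lines -/

section Arrangement

variable {K : Type*} [Field K]

theorem exists_eq_of_isHomogeneous_one {p : MvPolynomial (Fin 2) K} (hp : p.IsHomogeneous 1) :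
    ∃ a b : K, p = MvPolynomial.C a * MvPolynomial.X 0 + MvPolynomial.C b * MvPolynomial.X 1 := by
  rw [p.as_sum]
  refine Finset.sum_induction _ (fun q => ∃ a b : K,
    q = MvPolynomial.C a * MvPolynomial.X 0 + MvPolynomial.C b * MvPolynomial.X 1) ?_ ?_ ?_
  · rintro _ _ ⟨a, b, rfl⟩ ⟨a', b', rfl⟩
    exact ⟨a + a', b + b', by simp only [map_add]; ring⟩
  · exact ⟨0, 0, by simp⟩
  · intro m hm
    have hdeg : m.degree = 1 := by
      rw [Finsupp.degree_eq_weight_one]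
      exact hp (MvPolynomial.mem_support_iff.1 hm)
    obtain ⟨i, rfl⟩ : ∃ i, m = Finsupp.single i 1 := (Finsupp.sum_eq_one_iff m).1 hdeg
    fin_cases i
    · exact ⟨p.coeff (Finsupp.single 0 1), 0, by simp [MvPolynomial.C_mul_X_eq_monomial]⟩
    · exact ⟨0, p.coeff (Finsupp.single 1 1), by simp [MvPolynomial.C_mul_X_eq_monomial]⟩

/-- The restriction of polynomials to the line spanned by `v`, parametrized by `t ↦ t v`. -/
noncomputable def restrict (v : Fin 2 → K) : MvPolynomial (Fin 2) K →ₐ[K] Polynomial K :=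
  MvPolynomial.aeval fun j => Polynomial.C (v j) * Polynomial.X

theorem restrict_eq_of_isHomogeneous_one {p : MvPolynomial (Fin 2) K} (hp : p.IsHomogeneous 1)
    (v : Fin 2 → K) : restrict v p = Polynomial.C (MvPolynomial.eval v p) * Polynomial.X := by
  obtain ⟨a, b, rfl⟩ := exists_eq_of_isHomogeneous_one hp
  simp only [restrict, map_add, map_mul, MvPolynomial.aeval_X, MvPolynomial.algHom_C,
    MvPolynomial.eval_C, MvPolynomial.eval_X, Polynomial.algebraMap_eq]
  ring

/-- A section of `restrict v`: the substitution of a linear form with value `1` at `v`. -/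
theorem exists_restrict_section {v : Fin 2 → K} (hv : v ≠ 0) :
    ∃ j, v j ≠ 0 ∧ ∀ g, restrict v (Polynomial.aeval
      (MvPolynomial.C (v j)⁻¹ * MvPolynomial.X j : MvPolynomial (Fin 2) K) g) = g := by
  obtain ⟨j, hj⟩ := Function.ne_iff.1 hv
  refine ⟨j, hj, fun g => ?_⟩
  have h1 : restrict v (MvPolynomial.C (v j)⁻¹ * MvPolynomial.X j) = Polynomial.X := by
    rw [restrict, map_mul, MvPolynomial.aeval_X, MvPolynomial.algHom_C, Polynomial.algebraMap_eq,
      ← mul_assoc, ← Polynomial.C_mul, inv_mul_cancel₀ hj, Polynomial.C_1, one_mul]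
  rw [← Polynomial.aeval_algHom_apply, h1, Polynomial.aeval_X_left_apply]

/-- The kernel of the restriction to a line is generated by a linear form defining the line. -/
theorem dvd_of_restrict_eq_zero {p : MvPolynomial (Fin 2) K} (hp : p.IsHomogeneous 1) (hp0 : p ≠ 0)
    {v : Fin 2 → K} (hv : v ≠ 0) (hpv : MvPolynomial.eval v p = 0) {f : MvPolynomial (Fin 2) K}
    (hf : restrict v f = 0) : p ∣ f := by
  obtain ⟨j, hj, -⟩ := exists_restrict_section hv
  -- `p` is a multiple of the form `v 0 y - v 1 x`
  have hD : p ∣ MvPolynomial.C (v 0) * MvPolynomial.X 1 -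
      MvPolynomial.C (v 1) * MvPolynomial.X 0 := by
    obtain ⟨a, b, rfl⟩ := exists_eq_of_isHomogeneous_one hp
    simp only [map_add, map_mul, MvPolynomial.eval_C, MvPolynomial.eval_X] at hpv
    obtain ⟨c, hc0, ha, hb⟩ : ∃ c, c ≠ 0 ∧ a = -c * v 1 ∧ b = c * v 0 := by
      by_cases h0 : v 0 = 0
      · have h1 : v 1 ≠ 0 := by
          intro h1
          apply hv
          funext i
          fin_cases i
          · exact h0
          · exact h1
        have hb : b = 0 := by simpa [h0, h1] using hpv
        refine ⟨-(a / v 1), fun h => hp0 ?_, by field_simp, by simp [h0, hb]⟩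
        have ha : a = 0 := by simpa [h1] using h
        simp [ha, hb]
      · have ha : a = -(b / v 0) * v 1 := by
          field_simp
          linear_combination hpv
        refine ⟨b / v 0, fun h => hp0 ?_, ha, by field_simp⟩
        have hb : b = 0 := by simpa [h0] using h
        simp [ha, hb]
    refine ⟨MvPolynomial.C c⁻¹, ?_⟩
    have hcc : (MvPolynomial.C c * MvPolynomial.C c⁻¹ : MvPolynomial (Fin 2) K) = 1 := by
      rw [← MvPolynomial.C_mul, mul_inv_cancel₀ hc0, MvPolynomial.C_1]
    rw [ha, hb]
    simp only [map_mul, map_neg]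
    linear_combination (MvPolynomial.C (v 1) * MvPolynomial.X 0 -
      MvPolynomial.C (v 0) * MvPolynomial.X 1) * hcc
  -- modulo `p`, each variable is a multiple of the form used in the section of `restrict v`
  have hDk : ∀ k, p ∣ MvPolynomial.X k -
      MvPolynomial.C (v k) * (MvPolynomial.C (v j)⁻¹ * MvPolynomial.X j) := by
    intro k
    have hcc : (MvPolynomial.C (v j)⁻¹ * MvPolynomial.C (v j) : MvPolynomial (Fin 2) K) = 1 := by
      rw [← MvPolynomial.C_mul, inv_mul_cancel₀ hj, MvPolynomial.C_1]
    have e : MvPolynomial.X k - MvPolynomial.C (v k) * (MvPolynomial.C (v j)⁻¹ * MvPolynomial.X j) =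
        MvPolynomial.C (v j)⁻¹ * (MvPolynomial.C (v j) * MvPolynomial.X k -
          MvPolynomial.C (v k) * MvPolynomial.X j) := by
      linear_combination -MvPolynomial.X k * hcc
    rw [e]
    refine Dvd.dvd.mul_left ?_ _
    fin_cases j <;> fin_cases k
    · simp
    · exact hD
    · exact (dvd_sub_comm).1 hD
    · simp
  have hmk : Ideal.Quotient.mkₐ K (Ideal.span {p}) = (Ideal.Quotient.mkₐ K (Ideal.span {p})).comp
      ((Polynomial.aeval (MvPolynomial.C (v j)⁻¹ * MvPolynomial.X j)).comp (restrict v)) := by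
    refine MvPolynomial.algHom_ext fun k => ?_
    refine Ideal.Quotient.eq.2 (Ideal.mem_span_singleton.2 ?_)
    convert hDk k using 2
    change Polynomial.aeval _ (restrict v (MvPolynomial.X k)) = _
    rw [restrict, MvPolynomial.aeval_X, map_mul, Polynomial.aeval_C, Polynomial.aeval_X]
    rfl
  have h := DFunLike.congr_fun hmk f
  rw [AlgHom.comp_apply, AlgHom.comp_apply, hf, map_zero, map_zero] at h
  exact Ideal.mem_span_singleton.1 (Ideal.Quotient.eq_zero_iff_mem.1 h)

variable {r : ℕ} {p : Fin r → MvPolynomial (Fin 2) K} {v : Fin r → Fin 2 → K}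

theorem prod_dvd_of_restrict_eq_zero (hp : ∀ i, (p i).IsHomogeneous 1) (hp0 : ∀ i, p i ≠ 0)
    (hv : ∀ i, v i ≠ 0) (hpv : ∀ i j, MvPolynomial.eval (v j) (p i) = 0 ↔ i = j)
    (s : Finset (Fin r)) {f : MvPolynomial (Fin 2) K} (hf : ∀ i ∈ s, restrict (v i) f = 0) :
    ∏ i ∈ s, p i ∣ f := by
  classical
  induction s using Finset.induction_on with
  | empty => simp
  | insert i s hi ih =>
    obtain ⟨g, rfl⟩ := ih fun j hj => hf j (Finset.mem_insert_of_mem hj)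
    have h := hf i (Finset.mem_insert_self i s)
    rw [map_mul, map_prod] at h
    have hg := (mul_eq_zero.1 h).resolve_left (Finset.prod_ne_zero_iff.2 fun j hj => by
      rw [restrict_eq_of_isHomogeneous_one (hp j)]
      refine mul_ne_zero (Polynomial.C_ne_zero.2 fun h0 => hi ?_) Polynomial.X_ne_zero
      rwa [← (hpv j i).1 h0])
    rw [Finset.prod_insert hi, mul_comm (p i)]
    exact mul_dvd_mul_left _ (dvd_of_restrict_eq_zero (hp i) (hp0 i) (hv i) ((hpv i i).2 rfl) hg)

theorem restrict_eq_zero_of_dvd {p : MvPolynomial (Fin 2) K} (hp : p.IsHomogeneous 1)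
    {v : Fin 2 → K} (hpv : MvPolynomial.eval v p = 0) {f : MvPolynomial (Fin 2) K} (h : p ∣ f) :
    restrict v f = 0 := by
  obtain ⟨g, rfl⟩ := h
  rw [map_mul, restrict_eq_of_isHomogeneous_one hp, hpv, map_zero, zero_mul, zero_mul]

theorem mk_eq_zero_iff (f : MvPolynomial (Fin 2) K) :
    Ideal.Quotient.mkₐ K (arrangementIdeal p) f = 0 ↔ ∏ i, p i ∣ f :=
  Ideal.Quotient.eq_zero_iff_mem.trans Ideal.mem_span_singleton

/-- The coordinate ring of `r` lines through the origin: the branches are the lines, and the ideal of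
functions vanishing on all lines but one is the ideal of polynomials of order at least `r - 1`. -/
noncomputable def arrangementBranches (hp : ∀ i, (p i).IsHomogeneous 1) (hp0 : ∀ i, p i ≠ 0)
    (hv : ∀ i, v i ≠ 0) (hpv : ∀ i j, MvPolynomial.eval (v j) (p i) = 0 ↔ i = j) :
    Branches K (MvPolynomial (Fin 2) K) (MvPolynomial (Fin 2) K ⧸ arrangementIdeal p) (Fin r) :=
  have hsec := fun i => exists_restrict_section (hv i)
  have hker : ∀ i f, p i ∣ f → restrict (v i) f = 0 := fun i _ =>
    restrict_eq_zero_of_dvd (hp i) ((hpv i i).2 rfl)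
  have hprod : ∀ i, p i * ∏ j ∈ Finset.univ.erase i, p j = ∏ j, p j := fun i =>
    Finset.mul_prod_erase _ _ (Finset.mem_univ i)
  have hincl : ∀ i f, Ideal.Quotient.mkₐ K (arrangementIdeal p)
      ((∏ j ∈ Finset.univ.erase i, p j) * Polynomial.aeval
        (MvPolynomial.C (v i (hsec i).choose)⁻¹ * MvPolynomial.X (hsec i).choose)
          (restrict (v i) f)) =
      Ideal.Quotient.mkₐ K (arrangementIdeal p) ((∏ j ∈ Finset.univ.erase i, p j) * f) :=
    fun i f => by
      rw [← sub_eq_zero, ← map_sub, ← mul_sub, mk_eq_zero_iff, ← hprod i, mul_comm (p i)]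
      refine mul_dvd_mul_left _
        (dvd_of_restrict_eq_zero (hp i) (hp0 i) (hv i) ((hpv i i).2 rfl) ?_)
      rw [map_sub, (hsec i).choose_spec.2, sub_self]
  { proj := Ideal.Quotient.mkₐ K _
    proj_surjective := Ideal.Quotient.mkₐ_surjective K _
    branch := fun i => restrict (v i)
    branch_surjective := fun i g => ⟨_, (hsec i).choose_spec.2 g⟩
    eval := fun i => Ideal.Quotient.liftₐ _ (restrict (v i)) fun f hf =>
      hker i f ((Finset.dvd_prod_of_mem p (Finset.mem_univ i)).trans
        (Ideal.mem_span_singleton.1 hf))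
    eval_proj := fun i f => rfl
    p := p
    branch_p_self := fun i => hker i _ dvd_rfl
    branch_p_of_ne := fun i j h => by
      rw [restrict_eq_of_isHomogeneous_one (hp i)]
      exact mul_ne_zero (Polynomial.C_ne_zero.2 fun h0 => h ((hpv i j).1 h0).symm)
        Polynomial.X_ne_zero
    q := fun i => ∏ j ∈ Finset.univ.erase i, p j
    order := r - 1
    coeff := fun i => ∏ j ∈ Finset.univ.erase i, MvPolynomial.eval (v i) (p j)
    coeff_ne_zero := fun i => Finset.prod_ne_zero_iff.2 fun j hj h0 =>
      Finset.ne_of_mem_erase hj ((hpv j i).1 h0)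
    branch_q_self := fun i => by
      rw [map_prod, Finset.prod_congr rfl fun j _ => restrict_eq_of_isHomogeneous_one (hp j) (v i),
        Finset.prod_mul_distrib, Finset.prod_const, Finset.card_erase_of_mem (Finset.mem_univ i),
        Finset.card_univ, Fintype.card_fin, map_prod]
    branch_q_of_ne := fun i j h =>
      hker j _ (Finset.dvd_prod_of_mem p (Finset.mem_erase.2 ⟨h, Finset.mem_univ j⟩))
    incl := fun i => (Ideal.Quotient.mkₐ K (arrangementIdeal p)).toLinearMap ∘ₗ
      LinearMap.mulLeft K (∏ j ∈ Finset.univ.erase i, p j) ∘ₗ (Polynomial.aeval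
        (MvPolynomial.C (v i (hsec i).choose)⁻¹ * MvPolynomial.X (hsec i).choose)).toLinearMap
    incl_branch := hincl
    eq_zero_of_eval := fun a ha => by
      obtain ⟨f, rfl⟩ := Ideal.Quotient.mkₐ_surjective K _ a
      exact (mk_eq_zero_iff f).2
        (prod_dvd_of_restrict_eq_zero hp hp0 hv hpv Finset.univ fun i _ => ha i)
    mem_range_incl := fun i a ha => by
      obtain ⟨f, rfl⟩ := Ideal.Quotient.mkₐ_surjective K _ a
      obtain ⟨g, rfl⟩ := prod_dvd_of_restrict_eq_zero hp hp0 hv hpv (Finset.univ.erase i)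
        fun j hj => ha j (Finset.ne_of_mem_erase hj)
      exact ⟨restrict (v i) g, hincl i g⟩ }

end Arrangement

/-! ### Differential operators of a quotient -/

section Quotient

variable {K S : Type*} [Field K] [CommRing S] [Algebra K S]

/-- The operator induced on `S / J` by a differential operator of `S` that preserves `J`. -/
noncomputable def toQuotient (J : Ideal S) : preserving K J →+* ring K (S ⧸ J) where
  toFun θ := ⟨(J.restrictScalars K).mapQ (J.restrictScalars K) (θ : Module.End K S) θ.2.2, by
    have hπ := Ideal.Quotient.mkₐ_surjective K J
    refine (mem_ring_iff_isDiffOp hπ _).2 (IsDiffOp.of_comp_right (f := AlgHom.id K S)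
      (π := (Ideal.Quotient.mkₐ K J).toLinearMap) (fun _ _ => rfl) hπ ?_)
    exact isDiffOp_comp_of_mem_ring (Ideal.Quotient.mkₐ K J) θ.2.1⟩
  map_one' := Subtype.ext (LinearMap.ext (Ideal.Quotient.mk_surjective.forall.2 fun _ => rfl))
  map_zero' := Subtype.ext (LinearMap.ext (Ideal.Quotient.mk_surjective.forall.2 fun _ => rfl))
  map_mul' _ _ := Subtype.ext (LinearMap.ext (Ideal.Quotient.mk_surjective.forall.2 fun _ => rfl))
  map_add' _ _ := Subtype.ext (LinearMap.ext (Ideal.Quotient.mk_surjective.forall.2 fun _ => rfl))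

theorem toQuotient_apply_mk (J : Ideal S) (θ : preserving K J) (f : S) :
    (toQuotient J θ : Module.End K (S ⧸ J)) (Ideal.Quotient.mk J f) =
      Ideal.Quotient.mk J ((θ : Module.End K S) f) := rfl

theorem apply_mem_of_mem_idealMul {J : Ideal S} {ψ : Module.End K S} (hψ : ψ ∈ idealMul K J)
    (f : S) : ψ f ∈ J := by
  induction hψ using Submodule.span_induction with
  | mem ψ hψ =>
    obtain ⟨g, hg, θ, -, rfl⟩ := hψ
    exact J.mul_mem_right _ hg
  | zero => exact J.zero_mem
  | add a b _ _ ha hb => exact J.add_mem ha hb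
  | smul c a _ ha => exact (J.restrictScalars K).smul_mem c ha

/-- For a principal ideal `J`, an operator with values in `J` can be divided by the generator. -/
theorem mem_idealMul_of_forall_apply_mem [IsDomain S] (J : Ideal S) [hJ : J.IsPrincipal]
    {θ : Module.End K S} (hθ : θ ∈ ring K S) (h : ∀ f, θ f ∈ J) : θ ∈ idealMul K J := by
  obtain ⟨q, hq⟩ := hJ.principal
  replace hq : J = Ideal.span {q} := hq
  have hdvd : ∀ f, q ∣ θ f := fun f => Ideal.mem_span_singleton.1 (hq ▸ h f)
  rcases eq_or_ne q 0 with rfl | hq0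
  · have : θ = 0 := LinearMap.ext fun f => zero_dvd_iff.1 (hdvd f)
    rw [this]
    exact Submodule.zero_mem _
  · have hinj : Function.Injective (LinearMap.mulLeft K q) := fun _ _ e => mul_left_cancel₀ hq0 e
    obtain ⟨η, hη⟩ := exists_comp_eq_of_forall_mem_range hinj (ψ := θ)
      fun f => (hdvd f).imp fun _ e => e.symm
    have e : LinearMap.mulLeft K q * η = θ := LinearMap.ext hη
    have hη' : η ∈ ring K S := by
      have hs : Function.Surjective (AlgHom.id K S) := Function.surjective_id
      refine (mem_ring_iff_isDiffOp hs _).2 (IsDiffOp.of_comp_left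
        (σ := LinearMap.mulLeft K q) (fun _ _ => mul_left_comm _ _ _) hinj ?_)
      rw [← Module.End.mul_eq_comp, e]
      exact (mem_ring_iff_isDiffOp hs _).1 hθ
    exact Submodule.subset_span ⟨q, hq ▸ Ideal.mem_span_singleton_self q, η, hη', e.symm⟩

theorem mem_idealMulIdeal_iff [IsDomain S] (J : Ideal S) [J.IsPrincipal] (θ : preserving K J) :
    θ ∈ idealMulIdeal K J ↔ toQuotient J θ = 0 := by
  constructor
  · intro h
    exact Subtype.ext (LinearMap.ext (Ideal.Quotient.mk_surjective.forall.2 fun f =>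
      Ideal.Quotient.eq_zero_iff_mem.2 (apply_mem_of_mem_idealMul h f)))
  · intro h
    refine mem_idealMul_of_forall_apply_mem J θ.2.1 fun f => Ideal.Quotient.eq_zero_iff_mem.1 ?_
    rw [← toQuotient_apply_mk, h]
    rfl

theorem toQuotient_surjective [CharZero K] (J : Ideal (MvPolynomial (Fin 2) K)) :
    Function.Surjective (toQuotient (K := K) J) := by
  intro η
  have hπ := Ideal.Quotient.mkₐ_surjective K J
  obtain ⟨θ, hθ, e⟩ := exists_ring_lift (Ideal.Quotient.mkₐ K J) hπ
    (φ := (η : Module.End K (MvPolynomial (Fin 2) K ⧸ J)) ∘ₗ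
      (Ideal.Quotient.mkₐ K J).toLinearMap)
    (IsDiffOp.comp_right (fun _ _ => rfl) ((mem_ring_iff_isDiffOp hπ _).1 η.2))
  have he : ∀ f, Ideal.Quotient.mk J (θ f) =
      (η : Module.End K (MvPolynomial (Fin 2) K ⧸ J)) (Ideal.Quotient.mk J f) :=
    LinearMap.congr_fun e
  refine ⟨⟨θ, hθ, fun f hf => Ideal.Quotient.eq_zero_iff_mem.1 ?_⟩,
    Subtype.ext (LinearMap.ext (Ideal.Quotient.mk_surjective.forall.2 he))⟩
  rw [he, Ideal.Quotient.eq_zero_iff_mem.2 hf, map_zero]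

/-- `D(J) / J D(S) ≃ D(S / J)` for a principal ideal `J` of `S = K[x, y]`. -/
noncomputable def quotientEquiv [CharZero K] (J : Ideal (MvPolynomial (Fin 2) K)) [J.IsPrincipal] :
    (preserving K J ⧸ idealMulIdeal K J) ≃+* ring K (MvPolynomial (Fin 2) K ⧸ J) :=
  RingEquiv.ofBijective
    (Ideal.Quotient.lift _ (toQuotient J) fun θ => (mem_idealMulIdeal_iff J θ).1)
    ⟨RingHom.lift_injective_of_ker_le_ideal _ _ fun θ => (mem_idealMulIdeal_iff J θ).2,
      Ideal.Quotient.lift_surjective_of_surjective _ _ (toQuotient_surjective J)⟩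

theorem quotientEquiv_mk_apply [CharZero K] (J : Ideal (MvPolynomial (Fin 2) K)) [J.IsPrincipal]
    (θ : preserving K J) (f : MvPolynomial (Fin 2) K) :
    (quotientEquiv J (Ideal.Quotient.mk _ θ) : Module.End K (MvPolynomial (Fin 2) K ⧸ J))
      (Ideal.Quotient.mk J f) = Ideal.Quotient.mk J ((θ : Module.End K _) f) := rfl

end Quotient

/-! ### Lines through the origin -/

section Lines

variable {K ι : Type*} [Field K] {H : ι → Submodule K (Fin 2 → K)}

theorem exists_spanning_vectors (hH : Function.Injective H)
    (hline : ∀ i, Module.finrank K (H i) = 1) :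
    ∃ v : ι → Fin 2 → K, (∀ i, v i ≠ 0) ∧ ∀ i j, v j ∈ H i ↔ i = j := by
  have h1 : ∀ i, ∃ v : Fin 2 → K, v ≠ 0 ∧ Submodule.span K {v} = H i := fun i => by
    obtain ⟨v, hv, h⟩ := finrank_eq_one_iff'.1 (hline i)
    refine ⟨v, fun h0 => hv (Subtype.ext h0), le_antisymm ?_ fun w hw => ?_⟩
    · exact (Submodule.span_singleton_le_iff_mem _ _).2 v.2
    · obtain ⟨c, hc⟩ := h ⟨w, hw⟩
      exact Submodule.mem_span_singleton.2 ⟨c, congrArg Subtype.val hc⟩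
  choose v hv hspan using h1
  refine ⟨v, hv, fun i j => ⟨fun h => hH ?_, fun h => ?_⟩⟩
  · refine (Submodule.eq_of_le_of_finrank_eq ?_ ((hline j).trans (hline i).symm)).symm
    rw [← hspan j]
    exact (Submodule.span_singleton_le_iff_mem _ _).2 h
  · rw [h, ← hspan j]
    exact Submodule.mem_span_singleton_self _

theorem ne_zero_of_forall_eval_eq_zero_iff {p : MvPolynomial (Fin 2) K}
    {L : Submodule K (Fin 2 → K)} (hL : Module.finrank K L = 1)
    (h : ∀ v, MvPolynomial.eval v p = 0 ↔ v ∈ L) : p ≠ 0 := by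
  rintro rfl
  have : L = ⊤ := eq_top_iff.2 fun v _ => (h v).1 (map_zero _)
  rw [this, finrank_top, Module.finrank_fin_fun] at hL
  omega

end Lines

end DiffOp

theorem mainTheorem1 {K : Type*} [Field K] [CharZero K] (r : ℕ)
    -- a central arrangement of `r` distinct lines in `K²`
    (H : Fin r → Submodule K (Fin 2 → K)) (hH : Function.Injective H)
    (hline : ∀ i, Module.finrank K (H i) = 1)
    -- a linear form `p i` defining the line `H i`, for each `i`
    (p : Fin r → MvPolynomial (Fin 2) K) (hp : ∀ i, (p i).IsHomogeneous 1)
    (hpH : ∀ i, ∀ v : Fin 2 → K, MvPolynomial.eval v (p i) = 0 ↔ v ∈ H i) :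
    -- the canonical ring isomorphism `D(I) / I D(S) ≃ D(S / I)`
    (∃ e : (DiffOp.preserving K (DiffOp.arrangementIdeal p) ⧸
          DiffOp.idealMulIdeal K (DiffOp.arrangementIdeal p)) ≃+*
        DiffOp.ring K (MvPolynomial (Fin 2) K ⧸ DiffOp.arrangementIdeal p),
      ∀ (θ : DiffOp.preserving K (DiffOp.arrangementIdeal p)) (f : MvPolynomial (Fin 2) K),
        (e (Ideal.Quotient.mk _ θ) : Module.End K _)
            (Ideal.Quotient.mk (DiffOp.arrangementIdeal p) f) =
          Ideal.Quotient.mk (DiffOp.arrangementIdeal p) ((θ : Module.End K _) f)) ∧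
    -- `D(S / I)` is left and right Noetherian
    IsNoetherianRing (DiffOp.ring K (MvPolynomial (Fin 2) K ⧸ DiffOp.arrangementIdeal p)) ∧
    IsNoetherianRing (DiffOp.ring K (MvPolynomial (Fin 2) K ⧸ DiffOp.arrangementIdeal p))ᵐᵒᵖ ∧
    -- `D(I) / I D(S)` is left and right Noetherian
    IsNoetherianRing (DiffOp.preserving K (DiffOp.arrangementIdeal p) ⧸
      DiffOp.idealMulIdeal K (DiffOp.arrangementIdeal p)) ∧
    IsNoetherianRing (DiffOp.preserving K (DiffOp.arrangementIdeal p) ⧸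
      DiffOp.idealMulIdeal K (DiffOp.arrangementIdeal p))ᵐᵒᵖ := by
  obtain ⟨v, hv, hvH⟩ := DiffOp.exists_spanning_vectors hH hline
  let b := DiffOp.arrangementBranches hp
    (fun i => DiffOp.ne_zero_of_forall_eval_eq_zero_iff (hline i) (hpH i)) hv
    (fun i j => (hpH i (v j)).trans (hvH i j))
  have hleft := b.isNoetherianRing_ring
  have hright := b.isNoetherianRing_op_ring
  let e := DiffOp.quotientEquiv (DiffOp.arrangementIdeal p)
  exact ⟨⟨e, DiffOp.quotientEquiv_mk_apply _⟩, hleft, hright,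
    isNoetherianRing_of_ringEquiv _ e.symm, isNoetherianRing_of_ringEquiv _ (RingEquiv.op e.symm)⟩
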